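/- A \emph{globular set} $X$ consists of sets $X(n)$ ($n\ge 0$) of $n$-cells and maps $s,t:X(n+1)\to X(n)$ with $ss=st$ and $ts=tt$; a map of globular sets is a family of functions commuting with $s$ and $t$. Write $\mathcal G$ for the category of globular sets and $1$ for its terminal object (one cell in each dimension). A (small) \emph{strict $\omega$-category} is a globular set with identities $X(n)\to X(n+1)$ and, for $k<n$, a composition of pairs of $n$-cells $(x,y)$ with $t^{n-k}x=s^{n-k}y$, subject to the usual source/target, associativity, unit and (binary and nullary) interchange laws; strict $\omega$-functors are the maps of globular sets preserving identities and composition. Let $U$ be the forgetful functor from strict $\omega$-categories to $\mathcal G$. The globular set $\mathrm{pd}$ of \emph{pasting diagrams} is given by $\mathrm{pd}(0)=\{\bullet\}$ and $\mathrm{pd}(n+1)=\mathrm{pd}(n)^*$ (finite sequences in $\mathrm{pd}(n)$), with source and target both equal to the boundary $\partial$, where $\partial:\mathrm{pd}(1)\to\mathrm{pd}(0)$ is the unique map and $\partial:\mathrm{pd}(n+2)\to\mathrm{pd}(n+1)$ applies $\partial:\mathrm{pd}(n+1)\to\mathrm{pd}(n)$ to each entry of a sequence. To $\pi\in\mathrm{pd}(n)$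 is associated a globular set $\hat\pi$: if $n=0$, it has a single $0$-cell and no other cells; if $\pi=(\pi_1,\dots,\pi_r)\in\mathrm{pd}(n+1)$, then $\hat\pi(0)=\{0,1,\dots,r\}$ and $\hat\pi(k+1)=\coprod_{i=1}^r\hat\pi_i(k)$, where $s,t:\hat\pi(k+2)\to\hat\pi(k+1)$ are the disjoint unions of those of the $\hat\pi_i$, and $s(x)=i-1$, $t(x)=i$ for $x\in\hat\pi_i(0)\subseteq\hat\pi(1)$. \textbf{Theorem.} The functor $U$ has a left adjoint. Let $T$ be the induced monad on $\mathcal G$ (the free strict $\omega$-category monad). Then there are bijections \[ (TX)(n)\;\cong\;\coprod_{\pi\in\mathrm{pd}(n)}\mathcal G(\hat\pi,X)\qquad (X\in\mathcal G,\ n\ge 0), \] natural in $X$, and an isomorphism of globular sets $T1\cong\mathrm{pd}$, such that the index $\pi$ of the element corresponding to $a\in(TX)(n)$ is the image of $a$ under $(TX)(n)\to(T1)(n)\cong\mathrm{pd}(n)$, where the first map is induced by the unique map $X\to1$. -/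

import Mathlib

open CategoryTheory

universe u

/-- A globular set: sets of `n`-cells with source and target maps satisfying the globularity
relations. -/
structure GlobularSet : Type (u + 1) where
  cells : ℕ → Type u
  src : ∀ {n : ℕ}, cells (n + 1) → cells n
  tgt : ∀ {n : ℕ}, cells (n + 1) → cells n
  src_src : ∀ {n : ℕ} (x : cells (n + 2)), src (src x) = src (tgt x)
  tgt_tgt : ∀ {n : ℕ} (x : cells (n + 2)), tgt (src x) = tgt (tgt x)

namespace GlobularSet

/-- A map of globular sets: maps on cells commuting with sources and targets. -/
@[ext]
structure Hom (X Y : GlobularSet.{u}) : Type u where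
  app : ∀ n : ℕ, X.cells n → Y.cells n
  app_src : ∀ {n : ℕ} (x : X.cells (n + 1)), app n (X.src x) = Y.src (app (n + 1) x)
  app_tgt : ∀ {n : ℕ} (x : X.cells (n + 1)), app n (X.tgt x) = Y.tgt (app (n + 1) x)

instance : Category GlobularSet.{u} where
  Hom := Hom
  id X := { app := fun _ x => x, app_src := fun _ => rfl, app_tgt := fun _ => rfl }
  comp f g :=
    { app := fun n x => g.app n (f.app n x)
      app_src := fun x => by rw [f.app_src, g.app_src]
      app_tgt := fun x => by rw [f.app_tgt, g.app_tgt] }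

/-- The iterated source, from `n`-cells to `k`-cells, for `k ≤ n`. -/
def srcTo (X : GlobularSet.{u}) {k n : ℕ} (h : k ≤ n) : X.cells n → X.cells k :=
  Nat.leRecOn (C := fun m => X.cells m → X.cells k) h (fun f x => f (X.src x)) (fun x => x)

/-- The iterated target, from `n`-cells to `k`-cells, for `k ≤ n`. -/
def tgtTo (X : GlobularSet.{u}) {k n : ℕ} (h : k ≤ n) : X.cells n → X.cells k :=
  Nat.leRecOn (C := fun m => X.cells m → X.cells k) h (fun f x => f (X.tgt x)) (fun x => x)

/-- The terminal globular set, with one cell in each dimension. -/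
def one : GlobularSet.{u} where
  cells _ := PUnit
  src _ := PUnit.unit
  tgt _ := PUnit.unit
  src_src _ := rfl
  tgt_tgt _ := rfl

/-- The unique map to the terminal globular set. -/
def toOne (X : GlobularSet.{u}) : X ⟶ one.{u} :=
  Hom.mk (fun _ _ => PUnit.unit) (fun _ => rfl) (fun _ => rfl)

/-- The globular set with a single `0`-cell and no other cells. -/
def point : GlobularSet.{u} where
  cells
    | 0 => PUnit
    | _ + 1 => PEmpty
  src x := PEmpty.elim x
  tgt x := PEmpty.elim x
  src_src x := PEmpty.elim x
  tgt_tgt x := PEmpty.elim x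

/-- Given globular sets `Y 0, …, Y (r - 1)`, the globular set whose `0`-cells are `0, …, r` and
whose `(k + 1)`-cells are the disjoint union of the sets of `k`-cells of the `Y i`; the source and
target of a `1`-cell coming from a `0`-cell of `Y i` are `i` and `i + 1` respectively. -/
def chain {r : ℕ} (Y : Fin r → GlobularSet.{u}) : GlobularSet.{u} where
  cells
    | 0 => ULift.{u} (Fin (r + 1))
    | k + 1 => Σ i : Fin r, (Y i).cells k
  src {n} := match n with
    | 0 => fun x => ULift.up x.1.castSucc
    | _ + 1 => fun x => ⟨x.1, (Y x.1).src x.2⟩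
  tgt {n} := match n with
    | 0 => fun x => ULift.up x.1.succ
    | _ + 1 => fun x => ⟨x.1, (Y x.1).tgt x.2⟩
  src_src {n} x := match n with
    | 0 => rfl
    | _ + 1 => congrArg (Sigma.mk x.1) ((Y x.1).src_src x.2)
  tgt_tgt {n} x := match n with
    | 0 => rfl
    | _ + 1 => congrArg (Sigma.mk x.1) ((Y x.1).tgt_tgt x.2)

end GlobularSet

/-- The set of `n`-pasting diagrams: `Pd 0` is a singleton, `Pd (n + 1)` is the set of finite
sequences of elements of `Pd n`. -/
def Pd : ℕ → Type u
  | 0 => PUnit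
  | n + 1 => List (Pd n)

namespace Pd

/-- The boundary map on pasting diagrams. -/
def boundary : (n : ℕ) → Pd.{u} (n + 1) → Pd.{u} n
  | 0, _ => PUnit.unit
  | n + 1, π => List.map (boundary n) π

/-- The globular set of pasting diagrams; source and target are both the boundary map. -/
def globularSet : GlobularSet.{u} where
  cells := Pd.{u}
  src {n} π := boundary n π
  tgt {n} π := boundary n π
  src_src _ := rfl
  tgt_tgt _ := rfl

/-- The globular set represented by a pasting diagram. -/
def rep : (n : ℕ) → Pd.{u} n → GlobularSet.{u}
  | 0, _ => GlobularSet.point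
  | n + 1, π => GlobularSet.chain fun i : Fin (List.length π) => rep n (List.get π i)

end Pd

/-- A (small) strict `ω`-category: a globular set with identities and with a composition of
`n`-cells along `k`-cells for all `k < n`, written in diagrammatic order: `comp h x y _` is defined
when the `k`-dimensional target of `x` is the `k`-dimensional source of `y`. Each axiom
quantifies over proofs of the composability conditions needed to write it; the conditions on
boundaries, composites and identities follow from the conditions on the given cells by the
globularity relations and the source and target axioms, so they restrict nothing. -/
structure StrictOmegaCat : Type (u + 1) extends GlobularSet.{u} where
  /-- identities -/
  idn : ∀ {n : ℕ}, cells n → cells (n + 1)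
  /-- composition of `n`-cells along a common `k`-cell -/
  comp : ∀ {k n : ℕ} (h : k < n) (x y : cells n),
    toGlobularSet.tgtTo h.le x = toGlobularSet.srcTo h.le y → cells n
  src_idn : ∀ {n : ℕ} (x : cells n), src (idn x) = x
  tgt_idn : ∀ {n : ℕ} (x : cells n), tgt (idn x) = x
  src_comp_top : ∀ {n : ℕ} (x y : cells (n + 1)) (hxy),
    src (comp (Nat.lt_succ_self n) x y hxy) = src x
  tgt_comp_top : ∀ {n : ℕ} (x y : cells (n + 1)) (hxy),
    tgt (comp (Nat.lt_succ_self n) x y hxy) = tgt y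
  src_comp : ∀ {k n : ℕ} (h : k < n) (x y : cells (n + 1)) (hxy) (hs),
    src (comp (Nat.lt_succ_of_lt h) x y hxy) = comp h (src x) (src y) hs
  tgt_comp : ∀ {k n : ℕ} (h : k < n) (x y : cells (n + 1)) (hxy) (ht),
    tgt (comp (Nat.lt_succ_of_lt h) x y hxy) = comp h (tgt x) (tgt y) ht
  assoc : ∀ {k n : ℕ} (h : k < n) (x y z : cells n) (hxy) (hyz) (hxy_z) (hx_yz),
    comp h (comp h x y hxy) z hxy_z = comp h x (comp h y z hyz) hx_yz
  idn_comp : ∀ {k n : ℕ} (h : k < n) (x : cells n) (hx),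
    comp h (Nat.leRecOn h.le idn (toGlobularSet.srcTo h.le x)) x hx = x
  comp_idn : ∀ {k n : ℕ} (h : k < n) (x : cells n) (hx),
    comp h x (Nat.leRecOn h.le idn (toGlobularSet.tgtTo h.le x)) hx = x
  interchange : ∀ {k l n : ℕ} (hkl : k < l) (hln : l < n) (x x' y y' : cells n)
    (hx) (hy) (hxy) (hxy') (hk) (hl),
    comp (hkl.trans hln) (comp hln x x' hx) (comp hln y y' hy) hk =
      comp hln (comp (hkl.trans hln) x y hxy) (comp (hkl.trans hln) x' y' hxy') hl
  idn_interchange : ∀ {k n : ℕ} (h : k < n) (x y : cells n) (hxy) (hid),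
    comp (Nat.lt_succ_of_lt h) (idn x) (idn y) hid = idn (comp h x y hxy)

namespace StrictOmegaCat

/-- A strict `ω`-functor: a map of underlying globular sets preserving identities and
composition. The condition `hfxy` follows from `hxy`. -/
@[ext]
structure Hom (C D : StrictOmegaCat.{u}) : Type u
    extends GlobularSet.Hom C.toGlobularSet D.toGlobularSet where
  map_idn : ∀ {n : ℕ} (x : C.cells n), app (n + 1) (C.idn x) = D.idn (app n x)
  map_comp : ∀ {k n : ℕ} (h : k < n) (x y : C.cells n) (hxy) (hfxy),
    app n (C.comp h x y hxy) = D.comp h (app n x) (app n y) hfxy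

end StrictOmegaCat

namespace GlobularSet

/-- Maps of globular sets commute with iterated sources. -/
theorem Hom.app_srcTo {X Y : GlobularSet.{u}} (f : Hom X Y) {k n : ℕ} (h : k ≤ n)
    (x : X.cells n) : f.app k (X.srcTo h x) = Y.srcTo h (f.app n x) := by
  induction n, h using Nat.le_induction with
  | base => simp [srcTo, Nat.leRecOn_self]
  | succ m h ih =>
    simp only [srcTo, Nat.leRecOn_succ h] at ih ⊢
    rw [ih, f.app_src]

/-- Maps of globular sets commute with iterated targets. -/
theorem Hom.app_tgtTo {X Y : GlobularSet.{u}} (f : Hom X Y) {k n : ℕ} (h : k ≤ n)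
    (x : X.cells n) : f.app k (X.tgtTo h x) = Y.tgtTo h (f.app n x) := by
  induction n, h using Nat.le_induction with
  | base => simp [tgtTo, Nat.leRecOn_self]
  | succ m h ih =>
    simp only [tgtTo, Nat.leRecOn_succ h] at ih ⊢
    rw [ih, f.app_tgt]

end GlobularSet

namespace StrictOmegaCat

instance : Category StrictOmegaCat.{u} where
  Hom := Hom
  id C :=
    { app := fun _ x => x
      app_src := fun _ => rfl
      app_tgt := fun _ => rfl
      map_idn := fun _ => rfl
      map_comp := fun _ _ _ _ _ => rfl }
  comp f g :=
    { app := fun n x => g.app n (f.app n x)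
      app_src := fun x => by rw [f.app_src, g.app_src]
      app_tgt := fun x => by rw [f.app_tgt, g.app_tgt]
      map_idn := fun x => by rw [f.map_idn, g.map_idn]
      map_comp := fun h x y hxy hfxy => by
        have hf := by
          simpa only [f.toHom.app_tgtTo, f.toHom.app_srcTo] using congrArg (f.app _) hxy
        rw [f.map_comp h x y hxy hf, g.map_comp] }

/-- The forgetful functor from strict `ω`-categories to globular sets. -/
def forget : StrictOmegaCat.{u} ⥤ GlobularSet.{u} where
  obj C := C.toGlobularSet
  map f := f.toHom

end StrictOmegaCat

/-! The free strict `ω`-category is constructed explicitly by recursion on dimension, using one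
device: `shift X`, the globular set of cells of positive dimension of `X`. An `(n+1)`-cell of the
free category should be a path of `n`-cells of the free category on `shift X`, joined end to end at
0-cells of `X`. This gives `Word`, with `Valid` imposing composability at every level. Composition
along dimension 0 is concatenation; along dimension `k + 1` it composes corresponding entries along
dimension `k`. The axioms then reduce to facts about `append`, `map` and `zipWith`. The geometric
input is connectedness (`apply_first_eq_apply_last`): a valid word in `shift X` stays between two
fixed 0-cells of `X`.

For the universal property, `shift C` is again a strict `ω`-category, so a word is evaluated by
evaluating its entries in `shift C` and composing the results along dimension 0 (`pathComp`). That
evaluation is functorial comes down to `pathComp_append` (associativity and units), `idn_pathComp`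
(nullary interchange) and `pathComp_zipWith` (iterated binary interchange). Uniqueness
(`free_hom_ext`) holds because every word is built from single cells by identities and compositions.

Forgetting the cells of a word leaves nested lists, that is, a pasting diagram, its `shape`. A valid
word of shape `π` is the same thing as a map from the globular set of `π` to `X`: a map gives a word
(`toWord`), injectively since the intermediate vertices are determined, and surjectively since each
link is connected. Maps of globular sets act on words without changing the shape, which gives
naturality and the description of the index; over the terminal globular set only the shape remains.
Uniqueness of left adjoints transfers everything to an arbitrary left adjoint. -/

/-! ### Paths of edges and their end vertices -/

section Path

variable {V E E' : Type*}

/-- The sequence of edges is composable, starting at the given vertex. -/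
def IsPath (s t : E → V) : V → List E → Prop
  | _, [] => True
  | a, e :: l => s e = a ∧ IsPath s t (t e) l

/-- The final vertex of a path. -/
def pathEnd (t : E → V) : V → List E → V
  | a, [] => a
  | _, e :: l => pathEnd t (t e) l

theorem isPath_map {s t : E → V} (f : E' → E) (a : V) (l : List E') :
    IsPath s t a (l.map f) ↔ IsPath (fun e => s (f e)) (fun e => t (f e)) a l := by
  induction l generalizing a with
  | nil => rfl
  | cons e l ih => simp [IsPath, ih]

theorem pathEnd_map {t : E → V} (f : E' → E) (a : V) (l : List E') :
    pathEnd t a (l.map f) = pathEnd (fun e => t (f e)) a l := by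
  induction l generalizing a with
  | nil => rfl
  | cons e l ih => simp [pathEnd, ih]

theorem isPath_congr {s t s' t' : E → V} {a : V} {l : List E} (hs : ∀ e ∈ l, s e = s' e)
    (ht : ∀ e ∈ l, t e = t' e) : IsPath s t a l ↔ IsPath s' t' a l := by
  induction l generalizing a with
  | nil => rfl
  | cons e l ih =>
    simp only [List.mem_cons, forall_eq_or_imp] at hs ht
    simp [IsPath, hs.1, ht.1, ih hs.2 ht.2]

theorem pathEnd_congr {t t' : E → V} {a : V} {l : List E} (ht : ∀ e ∈ l, t e = t' e) :
    pathEnd t a l = pathEnd t' a l := by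
  induction l generalizing a with
  | nil => rfl
  | cons e l ih =>
    simp only [List.mem_cons, forall_eq_or_imp] at ht
    simp [pathEnd, ht.1, ih ht.2]

theorem pathEnd_append (t : E → V) (a : V) (l m : List E) :
    pathEnd t a (l ++ m) = pathEnd t (pathEnd t a l) m := by
  induction l generalizing a with
  | nil => rfl
  | cons e l ih => simp [pathEnd, ih]

theorem isPath_append {s t : E → V} {a : V} {l m : List E} :
    IsPath s t a (l ++ m) ↔ IsPath s t a l ∧ IsPath s t (pathEnd t a l) m := by
  induction l generalizing a with
  | nil => simp [IsPath, pathEnd]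
  | cons e l ih => simp [IsPath, pathEnd, ih, and_assoc]

theorem IsPath.image {V' : Type*} {s t : E → V} (g : V → V') {a : V} {l : List E}
    (h : IsPath s t a l) : IsPath (fun e => g (s e)) (fun e => g (t e)) (g a) l := by
  induction l generalizing a with
  | nil => trivial
  | cons e l ih => exact ⟨congrArg g h.1, ih h.2⟩

theorem pathEnd_image {V' : Type*} (t : E → V) (g : V → V') (a : V) (l : List E) :
    pathEnd (fun e => g (t e)) (g a) l = g (pathEnd t a l) := by
  induction l generalizing a with
  | nil => rfl
  | cons e l ih => exact ih _

end Path

/-! ### Words, their boundaries, identities and composites -/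

namespace GlobularSet

/-- The globular set of cells of positive dimension: the disjoint union of all hom globular
sets. -/
def shift (X : GlobularSet.{u}) : GlobularSet.{u} where
  cells n := X.cells (n + 1)
  src := X.src
  tgt := X.tgt
  src_src := X.src_src
  tgt_tgt := X.tgt_tgt

/-- Words of dimension `n`: a `0`-cell for `n = 0`, and for `n + 1` a starting `0`-cell with
a sequence of words of dimension `n` in the cells of positive dimension. -/
def Word : ℕ → GlobularSet.{u} → Type u
  | 0, X => X.cells 0
  | n + 1, X => X.cells 0 × List (Word n X.shift)

namespace Word

/-- The first `0`-cell of a word. -/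
def first : (n : ℕ) → {X : GlobularSet.{u}} → Word n X → X.cells 0
  | 0, _, x => x
  | _ + 1, _, x => x.1

/-- The last `0`-cell of a word. -/
def last : (n : ℕ) → {X : GlobularSet.{u}} → Word n X → X.cells 0
  | 0, _, x => x
  | n + 1, X, x => pathEnd (fun y => X.tgt (last n (X := X.shift) y)) x.1 x.2

/-- The words that are composable at every level. -/
def Valid : (n : ℕ) → {X : GlobularSet.{u}} → Word n X → Prop
  | 0, _, _ => True
  | n + 1, X, x =>
    IsPath (fun y => X.src (first n (X := X.shift) y)) (fun y => X.tgt (last n (X := X.shift) y))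
      x.1 x.2 ∧ ∀ y ∈ x.2, Valid n (X := X.shift) y

/-- The source of a word. -/
def src : (n : ℕ) → {X : GlobularSet.{u}} → Word (n + 1) X → Word n X
  | 0, _, x => first 1 x
  | n + 1, X, x => (x.1, List.map (src n (X := X.shift)) x.2)

/-- The target of a word. -/
def tgt : (n : ℕ) → {X : GlobularSet.{u}} → Word (n + 1) X → Word n X
  | 0, _, x => last 1 x
  | n + 1, X, x => (x.1, List.map (tgt n (X := X.shift)) x.2)

/-- The identity on a word. -/
def idn : (n : ℕ) → {X : GlobularSet.{u}} → Word n X → Word (n + 1) X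
  | 0, _, x => (x, [])
  | n + 1, X, x => (x.1, List.map (idn n (X := X.shift)) x.2)

/-- The composite of words of dimension `n` along dimension `k`. -/
def comp : (k n : ℕ) → {X : GlobularSet.{u}} → Word n X → Word n X → Word n X
  | _, 0, _, x, _ => x
  | 0, _ + 1, _, x, y => (x.1, x.2 ++ y.2)
  | k + 1, n + 1, X, x, y => (x.1, List.zipWith (comp k n (X := X.shift)) x.2 y.2)

/-- The iterated source of a word. -/
def srcTo : (k n : ℕ) → k ≤ n → {X : GlobularSet.{u}} → Word n X → Word k X
  | 0, n, _, _, x => first n x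
  | _ + 1, 0, h, _, _ => absurd h (Nat.not_succ_le_zero _)
  | k + 1, n + 1, h, X, x => (x.1, List.map (srcTo k n (Nat.le_of_succ_le_succ h) (X := X.shift)) x.2)

/-- The iterated target of a word. -/
def tgtTo : (k n : ℕ) → k ≤ n → {X : GlobularSet.{u}} → Word n X → Word k X
  | 0, n, _, _, x => last n x
  | _ + 1, 0, h, _, _ => absurd h (Nat.not_succ_le_zero _)
  | k + 1, n + 1, h, X, x => (x.1, List.map (tgtTo k n (Nat.le_of_succ_le_succ h) (X := X.shift)) x.2)

/-- The iterated identity on a word. -/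
def idnTo : (k n : ℕ) → k ≤ n → {X : GlobularSet.{u}} → Word k X → Word n X
  | 0, 0, _, _, x => x
  | 0, _ + 1, _, _, x => (x, [])
  | _ + 1, 0, h, _, _ => absurd h (Nat.not_succ_le_zero _)
  | k + 1, n + 1, h, X, x => (x.1, List.map (idnTo k n (Nat.le_of_succ_le_succ h) (X := X.shift)) x.2)

/-- A function that does not distinguish the ends of any 1-cell is constant along a path. An entry
`y` of the path is itself a word, so its step is bridged by the same statement one level up, with
`X.tgt` on `shift X` as the function; this is why `q` is left general. -/
theorem apply_first_eq_apply_last {V : Type u} {n : ℕ} {X : GlobularSet.{u}} (q : X.cells 0 → V)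
    (hq : ∀ e : X.cells 1, q (X.src e) = q (X.tgt e)) (x : Word n X) (hx : Valid n x) :
    q (first n x) = q (last n x) := by
  induction n generalizing X V with
  | zero => rfl
  | succ n ih =>
    obtain ⟨a, l⟩ := x
    obtain ⟨hp, hv⟩ := hx
    change q a = q (pathEnd _ a l)
    dsimp only at hp hv
    induction l generalizing a with
    | nil => rfl
    | cons y l ihl =>
      simp only [List.mem_cons, forall_eq_or_imp] at hv
      have := ihl _ hp.2 hv.2
      rw [pathEnd, ← this, ← hp.1]
      exact (hq _).trans (congrArg q (ih (X := X.shift) X.tgt X.tgt_tgt y hv.1))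

theorem src_first_eq {n : ℕ} {X : GlobularSet.{u}} (x : Word n X.shift) (hx : Valid n x) :
    X.src (first n x) = X.src (last n x) :=
  apply_first_eq_apply_last (X := X.shift) X.src X.src_src x hx

theorem tgt_first_eq {n : ℕ} {X : GlobularSet.{u}} (x : Word n X.shift) (hx : Valid n x) :
    X.tgt (first n x) = X.tgt (last n x) :=
  apply_first_eq_apply_last (X := X.shift) X.tgt X.tgt_tgt x hx

theorem first_src {n : ℕ} {X : GlobularSet.{u}} (x : Word (n + 1) X) :
    first n (src n x) = first (n + 1) x := by
  cases n <;> rfl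

theorem last_tgt {n : ℕ} {X : GlobularSet.{u}} (x : Word (n + 1) X) :
    last n (tgt n x) = last (n + 1) x := by
  induction n generalizing X with
  | zero => rfl
  | succ n ih =>
    refine (pathEnd_map _ _ _).trans (pathEnd_congr fun y _ => ?_)
    exact congrArg X.tgt (ih (X := X.shift) y)

/-- In the lowest dimension the target of a word is its last cell rather than its first;
connectedness shows that these two still have the same source in `X`. -/
theorem src_first_tgt {n : ℕ} {X : GlobularSet.{u}} (x : Word (n + 1) X.shift)
    (hx : Valid (n + 1) x) : X.src (first n (tgt n x)) = X.src (first (n + 1) x) := by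
  cases n with
  | zero => exact (src_first_eq x hx).symm
  | succ n => rfl

theorem tgt_last_src {n : ℕ} {X : GlobularSet.{u}} (x : Word (n + 1) X.shift)
    (hx : Valid (n + 1) x) : X.tgt (last n (src n x)) = X.tgt (last (n + 1) x) := by
  induction n generalizing X with
  | zero => exact tgt_first_eq x hx
  | succ n ih =>
    refine congrArg X.tgt ((pathEnd_map _ _ _).trans (pathEnd_congr fun y hy => ?_))
    exact ih (X := X.shift) y (hx.2 y hy)

/-- Passing to sources can change the last cell of an entry, but not the target of that cell in `X`,
so the entries still join up. -/
theorem Valid.src {n : ℕ} {X : GlobularSet.{u}} {x : Word (n + 1) X} (hx : Valid (n + 1) x) :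
    Valid n (src n x) := by
  induction n generalizing X with
  | zero => trivial
  | succ n ih =>
    refine ⟨(isPath_map (Word.src _ (X := X.shift)) x.1 x.2).2
      ((isPath_congr (l := x.2) (fun y hy => ?_) fun y hy => ?_).1 hx.1), ?_⟩
    · exact congrArg X.src (first_src (X := X.shift) y).symm
    · exact (tgt_last_src y (hx.2 y hy)).symm
    · rintro _ hy
      obtain ⟨y, hy', rfl⟩ := List.mem_map.1 hy
      exact ih (X := X.shift) (hx.2 y hy')

theorem Valid.tgt {n : ℕ} {X : GlobularSet.{u}} {x : Word (n + 1) X} (hx : Valid (n + 1) x) :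
    Valid n (tgt n x) := by
  induction n generalizing X with
  | zero => trivial
  | succ n ih =>
    refine ⟨(isPath_map (Word.tgt _ (X := X.shift)) x.1 x.2).2
      ((isPath_congr (l := x.2) (fun y hy => ?_) fun y hy => ?_).1 hx.1), ?_⟩
    · exact (src_first_tgt y (hx.2 y hy)).symm
    · exact congrArg X.tgt (last_tgt (X := X.shift) y).symm
    · rintro _ hy
      obtain ⟨y, hy', rfl⟩ := List.mem_map.1 hy
      exact ih (X := X.shift) (hx.2 y hy')

theorem src_src {n : ℕ} {X : GlobularSet.{u}} (x : Word (n + 2) X) :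
    Word.src n (Word.src (n + 1) x) = Word.src n (Word.tgt (n + 1) x) := by
  induction n generalizing X with
  | zero => rfl
  | succ n ih =>
    refine Prod.ext rfl (List.map_map.trans (Eq.trans ?_ List.map_map.symm))
    exact List.map_congr_left fun y _ => ih (X := X.shift) y

/-- Validity is needed here, unlike for sources: in the lowest case the two sides replace each entry
by its first and by its last cell, whose targets agree by connectedness. -/
theorem tgt_tgt {n : ℕ} {X : GlobularSet.{u}} (x : Word (n + 2) X) (hx : Valid (n + 2) x) :
    Word.tgt n (Word.src (n + 1) x) = Word.tgt n (Word.tgt (n + 1) x) := by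
  induction n generalizing X with
  | zero =>
    refine (pathEnd_map _ _ _).trans (Eq.trans ?_ (pathEnd_map _ _ _).symm)
    exact pathEnd_congr fun y hy => tgt_first_eq y (hx.2 y hy)
  | succ n ih =>
    refine Prod.ext rfl (List.map_map.trans (Eq.trans ?_ List.map_map.symm))
    exact List.map_congr_left fun y hy => ih (X := X.shift) y (hx.2 y hy)

theorem first_idn {n : ℕ} {X : GlobularSet.{u}} (x : Word n X) :
    first (n + 1) (idn n x) = first n x := by
  cases n <;> rfl

theorem last_idn {n : ℕ} {X : GlobularSet.{u}} (x : Word n X) :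
    last (n + 1) (idn n x) = last n x := by
  induction n generalizing X with
  | zero => rfl
  | succ n ih =>
    refine (pathEnd_map _ _ _).trans (pathEnd_congr fun y _ => ?_)
    exact congrArg X.tgt (ih (X := X.shift) y)

theorem Valid.idn {n : ℕ} {X : GlobularSet.{u}} {x : Word n X} (hx : Valid n x) :
    Valid (n + 1) (idn n x) := by
  induction n generalizing X with
  | zero => exact ⟨trivial, fun _ h => absurd h List.not_mem_nil⟩
  | succ n ih =>
    refine ⟨(isPath_map (Word.idn _ (X := X.shift)) x.1 x.2).2
      ((isPath_congr (l := x.2) (fun y hy => ?_) fun y hy => ?_).1 hx.1), ?_⟩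
    · exact congrArg X.src (first_idn (X := X.shift) y).symm
    · exact congrArg X.tgt (last_idn (X := X.shift) y).symm
    · rintro _ hy
      obtain ⟨y, hy', rfl⟩ := List.mem_map.1 hy
      exact ih (X := X.shift) (hx.2 y hy')

theorem src_idn {n : ℕ} {X : GlobularSet.{u}} (x : Word n X) : Word.src n (Word.idn n x) = x := by
  induction n generalizing X with
  | zero => rfl
  | succ n ih =>
    refine Prod.ext rfl ?_
    simp only [Word.src, Word.idn, List.map_map]
    exact (List.map_congr_left fun y _ => ih (X := X.shift) y).trans (List.map_id _)

theorem tgt_idn {n : ℕ} {X : GlobularSet.{u}} (x : Word n X) : Word.tgt n (Word.idn n x) = x := by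
  induction n generalizing X with
  | zero => rfl
  | succ n ih =>
    refine Prod.ext rfl ?_
    simp only [Word.tgt, Word.idn, List.map_map]
    exact (List.map_congr_left fun y _ => ih (X := X.shift) y).trans (List.map_id _)

theorem srcTo_self {n : ℕ} {X : GlobularSet.{u}} (x : Word n X) : srcTo n n le_rfl x = x := by
  induction n generalizing X with
  | zero => rfl
  | succ n ih =>
    exact Prod.ext rfl ((List.map_congr_left fun y _ => ih (X := X.shift) y).trans (List.map_id _))

theorem tgtTo_self {n : ℕ} {X : GlobularSet.{u}} (x : Word n X) : tgtTo n n le_rfl x = x := by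
  induction n generalizing X with
  | zero => rfl
  | succ n ih =>
    exact Prod.ext rfl ((List.map_congr_left fun y _ => ih (X := X.shift) y).trans (List.map_id _))

theorem idnTo_self {n : ℕ} {X : GlobularSet.{u}} (x : Word n X) : idnTo n n le_rfl x = x := by
  induction n generalizing X with
  | zero => rfl
  | succ n ih =>
    exact Prod.ext rfl ((List.map_congr_left fun y _ => ih (X := X.shift) y).trans (List.map_id _))

theorem srcTo_src {k n : ℕ} (h : k ≤ n) {X : GlobularSet.{u}} (x : Word (n + 1) X) :
    srcTo k n h (Word.src n x) = srcTo k (n + 1) (Nat.le_succ_of_le h) x := by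
  induction n generalizing k X with
  | zero =>
    obtain rfl := Nat.le_zero.1 h
    rfl
  | succ n ih =>
    cases k with
    | zero => rfl
    | succ k =>
      refine Prod.ext rfl ?_
      simp only [Word.src, srcTo, List.map_map]
      exact List.map_congr_left fun y _ => ih _ (X := X.shift) y

theorem tgtTo_tgt {k n : ℕ} (h : k ≤ n) {X : GlobularSet.{u}} (x : Word (n + 1) X) :
    tgtTo k n h (Word.tgt n x) = tgtTo k (n + 1) (Nat.le_succ_of_le h) x := by
  induction n generalizing k X with
  | zero =>
    obtain rfl := Nat.le_zero.1 h
    rfl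
  | succ n ih =>
    cases k with
    | zero => exact last_tgt x
    | succ k =>
      refine Prod.ext rfl ?_
      simp only [Word.tgt, tgtTo, List.map_map]
      exact List.map_congr_left fun y _ => ih _ (X := X.shift) y

theorem idn_idnTo {k n : ℕ} (h : k ≤ n) {X : GlobularSet.{u}} (x : Word k X) :
    Word.idn n (idnTo k n h x) = idnTo k (n + 1) (Nat.le_succ_of_le h) x := by
  induction n generalizing k X with
  | zero =>
    obtain rfl := Nat.le_zero.1 h
    rfl
  | succ n ih =>
    cases k with
    | zero => rfl
    | succ k =>
      refine Prod.ext rfl ?_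
      simp only [Word.idn, idnTo, List.map_map]
      exact List.map_congr_left fun y _ => ih _ (X := X.shift) y

/-- Two words of dimension `n` are composable along dimension `k`. -/
def Composable : (k n : ℕ) → {X : GlobularSet.{u}} → Word n X → Word n X → Prop
  | _, 0, _, _, _ => False
  | 0, n + 1, _, x, y => last (n + 1) x = first (n + 1) y
  | k + 1, n + 1, X, x, y => x.1 = y.1 ∧ List.Forall₂ (Composable k n (X := X.shift)) x.2 y.2

theorem not_composable_zero {k : ℕ} {X : GlobularSet.{u}} {x y : Word 0 X} :
    ¬ Composable k 0 x y := by
  cases k <;> exact id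

/-- Equality of iterated boundaries is unwound level by level. Above dimension 0 it forces the two
lists to have equal length with entries matching in pairs, so that `zipWith` discards nothing. -/
theorem composable_of_eq {k n : ℕ} (h : k < n) {X : GlobularSet.{u}} {x y : Word n X}
    (hxy : tgtTo k n h.le x = srcTo k n h.le y) : Composable k n x y := by
  induction n generalizing k X with
  | zero => exact absurd h (Nat.not_lt_zero _)
  | succ n ih =>
    cases k with
    | zero => exact hxy
    | succ k =>
      refine ⟨congrArg (fun p : Word (k + 1) X => p.1) hxy, ?_⟩
      have h2 : List.map (tgtTo k n (Nat.lt_of_succ_lt_succ h).le) x.2 =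
        List.map (srcTo k n (Nat.lt_of_succ_lt_succ h).le) y.2 :=
        congrArg (fun p : Word (k + 1) X => p.2) hxy
      rw [← List.forall₂_eq_eq_eq, List.forall₂_map_left_iff, List.forall₂_map_right_iff] at h2
      exact h2.imp fun _ _ => ih (Nat.lt_of_succ_lt_succ h) (X := X.shift)

theorem first_comp {k n : ℕ} {X : GlobularSet.{u}} (x y : Word n X) :
    first n (comp k n x y) = first n x := by
  cases n <;> cases k <;> rfl

theorem pathEnd_zipWith {V E : Type*} {t : E → V} {f : E → E → E} {a : V} {l m : List E}
    (h : List.Forall₂ (fun y z => t (f y z) = t z) l m) :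
    pathEnd t a (List.zipWith f l m) = pathEnd t a m := by
  induction h generalizing a with
  | nil => rfl
  | cons h _ ih => simp [pathEnd, h, ih]

theorem last_comp {k n : ℕ} {X : GlobularSet.{u}} {x y : Word n X} (h : Composable k n x y) :
    last n (comp k n x y) = last n y := by
  induction n generalizing k X with
  | zero => exact (not_composable_zero h).elim
  | succ n ih =>
    cases k with
    | zero =>
      refine (pathEnd_append _ _ _ _).trans ?_
      exact congrArg (fun a => pathEnd _ a y.2) h
    | succ k =>
      obtain ⟨a, l⟩ := x
      obtain ⟨b, m⟩ := y
      obtain ⟨rfl, h⟩ := h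
      exact pathEnd_zipWith (h.imp fun y z hyz => congrArg X.tgt (ih (X := X.shift) hyz))

/-- Composable words lie in one connected component: either the first ends where the second begins,
or both begin at the same 0-cell. -/
theorem apply_last_eq_of_composable {V : Type u} {k n : ℕ} {X : GlobularSet.{u}}
    (q : X.cells 0 → V) (hq : ∀ e : X.cells 1, q (X.src e) = q (X.tgt e)) {x y : Word n X}
    (hx : Valid n x) (hy : Valid n y) (h : Composable k n x y) : q (last n x) = q (last n y) := by
  cases n with
  | zero => exact (not_composable_zero h).elim
  | succ n =>
    rw [← apply_first_eq_apply_last q hq y hy]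
    cases k with
    | zero => exact congrArg q h
    | succ k => exact (apply_first_eq_apply_last q hq x hx).symm.trans (congrArg q h.1)

/-- Concatenated paths are a path. When entries are composed pairwise, each composite begins where
its left factor does, and its last cell has the same target in `X` as that of the left factor, so
the result runs along the left-hand path. -/
theorem Valid.comp {k n : ℕ} {X : GlobularSet.{u}} {x y : Word n X}
    (hx : Valid n x) (hy : Valid n y) (h : Composable k n x y) : Valid n (comp k n x y) := by
  induction n generalizing k X with
  | zero => exact (not_composable_zero h).elim
  | succ n ih =>
    obtain ⟨a, l⟩ := x
    obtain ⟨b, m⟩ := y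
    obtain ⟨hpx, hvx⟩ := hx
    obtain ⟨hpy, hvy⟩ := hy
    cases k with
    | zero =>
      obtain rfl : _ = b := h
      refine ⟨isPath_append.2 ⟨hpx, hpy⟩, fun z hz => ?_⟩
      exact (List.mem_append.1 hz).elim (hvx z) (hvy z)
    | succ k =>
      obtain ⟨rfl, h⟩ := h
      change List.Forall₂ _ l m at h
      dsimp only at hpx hpy hvx hvy
      change IsPath _ _ a (List.zipWith _ l m) ∧ ∀ y ∈ List.zipWith _ l m, _
      -- Only the left-hand path guides the result; dropping the other hypothesis keeps it out of
      -- the induction over the paired lists.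
      clear hpy
      induction h generalizing a with
      | nil => exact ⟨trivial, fun _ h => absurd h List.not_mem_nil⟩
      | @cons y z l m hyz _ ihl =>
        simp only [List.mem_cons, forall_eq_or_imp] at hvx hvy
        obtain ⟨h1, h2⟩ := ihl _ hpx.2 hvx.2 hvy.2
        refine ⟨⟨(congrArg X.src (first_comp (X := X.shift) y z)).trans hpx.1, ?_⟩, ?_⟩
        · have := (congrArg X.tgt (last_comp (X := X.shift) hyz)).trans
            (apply_last_eq_of_composable (X := X.shift) X.tgt X.tgt_tgt hvx.1 hvy.1 hyz).symm
          dsimp only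
          rwa [this]
        · rintro w hw
          rcases List.mem_cons.1 hw with rfl | hw
          · exact ih (X := X.shift) hvx.1 hvy.1 hyz
          · exact h2 w hw

/-- No composability is needed: `map` commutes with concatenation, and with zipping once the entries
do. -/
theorem src_comp {k n : ℕ} (h : k < n) {X : GlobularSet.{u}} (x y : Word (n + 1) X) :
    Word.src n (Word.comp k (n + 1) x y) = Word.comp k n (Word.src n x) (Word.src n y) := by
  induction n generalizing k X with
  | zero => exact absurd h (Nat.not_lt_zero _)
  | succ n ih =>
    refine Prod.ext (by cases k <;> rfl) ?_
    cases k with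
    | zero => exact List.map_append
    | succ k =>
      simp only [Word.src, Word.comp, List.map_zipWith, List.zipWith_map]
      congr 1
      funext y z
      exact ih (Nat.lt_of_succ_lt_succ h) (X := X.shift) y z

theorem tgt_comp {k n : ℕ} (h : k < n) {X : GlobularSet.{u}} (x y : Word (n + 1) X) :
    Word.tgt n (Word.comp k (n + 1) x y) = Word.comp k n (Word.tgt n x) (Word.tgt n y) := by
  induction n generalizing k X with
  | zero => exact absurd h (Nat.not_lt_zero _)
  | succ n ih =>
    refine Prod.ext (by cases k <;> rfl) ?_
    cases k with
    | zero => exact List.map_append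
    | succ k =>
      simp only [Word.tgt, Word.comp, List.map_zipWith, List.zipWith_map]
      congr 1
      funext y z
      exact ih (Nat.lt_of_succ_lt_succ h) (X := X.shift) y z

theorem src_comp_top {n : ℕ} {X : GlobularSet.{u}} {x y : Word (n + 1) X}
    (h : Composable n (n + 1) x y) : Word.src n (Word.comp n (n + 1) x y) = Word.src n x := by
  induction n generalizing X with
  | zero => rfl
  | succ n ih =>
    obtain ⟨a, l⟩ := x
    obtain ⟨b, m⟩ := y
    refine Prod.ext rfl ?_
    simp only [Word.src, Word.comp]
    have h2 : List.Forall₂ _ l m := h.2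
    clear h
    induction h2 with
    | nil => rfl
    | cons h _ ihl => simp only [List.zipWith_cons_cons, List.map_cons, ihl, ih (X := X.shift) h]

theorem tgt_comp_top {n : ℕ} {X : GlobularSet.{u}} {x y : Word (n + 1) X}
    (h : Composable n (n + 1) x y) : Word.tgt n (Word.comp n (n + 1) x y) = Word.tgt n y := by
  induction n generalizing X with
  | zero => exact last_comp h
  | succ n ih =>
    obtain ⟨a, l⟩ := x
    obtain ⟨b, m⟩ := y
    refine Prod.ext h.1 ?_
    simp only [Word.tgt, Word.comp]
    have h2 : List.Forall₂ _ l m := h.2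
    clear h
    induction h2 with
    | nil => rfl
    | cons h _ ihl => simp only [List.zipWith_cons_cons, List.map_cons, ihl, ih (X := X.shift) h]

theorem comp_assoc {k n : ℕ} {X : GlobularSet.{u}} (x y z : Word n X) :
    Word.comp k n (Word.comp k n x y) z = Word.comp k n x (Word.comp k n y z) := by
  induction n generalizing k X with
  | zero => cases k <;> rfl
  | succ n ih =>
    cases k with
    | zero => exact Prod.ext rfl (List.append_assoc _ _ _)
    | succ k =>
      refine Prod.ext rfl ?_
      obtain ⟨a, l⟩ := x
      obtain ⟨b, m⟩ := y
      obtain ⟨c, p⟩ := z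
      simp only [Word.comp]
      induction l generalizing m p with
      | nil => simp
      | cons y l ihl =>
        cases m <;> cases p <;> simp [ihl, ih (X := X.shift)]

theorem idnTo_comp {k n : ℕ} (h : k < n) {X : GlobularSet.{u}} (x : Word n X) :
    Word.comp k n (idnTo k n h.le (srcTo k n h.le x)) x = x := by
  induction n generalizing k X with
  | zero => exact absurd h (Nat.not_lt_zero _)
  | succ n ih =>
    cases k with
    | zero => rfl
    | succ k =>
      refine Prod.ext rfl ?_
      simp only [Word.comp, idnTo, srcTo, List.map_map, List.zipWith_map_left, List.zipWith_self]
      exact (List.map_congr_left fun y _ =>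
        ih (Nat.lt_of_succ_lt_succ h) (X := X.shift) y).trans (List.map_id _)

theorem comp_idnTo {k n : ℕ} (h : k < n) {X : GlobularSet.{u}} (x : Word n X) :
    Word.comp k n x (idnTo k n h.le (tgtTo k n h.le x)) = x := by
  induction n generalizing k X with
  | zero => exact absurd h (Nat.not_lt_zero _)
  | succ n ih =>
    cases k with
    | zero => exact Prod.ext rfl (List.append_nil _)
    | succ k =>
      refine Prod.ext rfl ?_
      simp only [Word.comp, idnTo, tgtTo, List.map_map, List.zipWith_map_right, List.zipWith_self]
      exact (List.map_congr_left fun y _ =>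
        ih (Nat.lt_of_succ_lt_succ h) (X := X.shift) y).trans (List.map_id _)

/-- For `k = 0` this says that zipping distributes over concatenation, which requires the first two
lists to have equal length; composability of `x` and `x'` supplies that. -/
theorem interchange {k l n : ℕ} (hkl : k < l) {X : GlobularSet.{u}} {x x' y y' : Word n X}
    (hx : Composable l n x x') :
    Word.comp k n (Word.comp l n x x') (Word.comp l n y y') =
      Word.comp l n (Word.comp k n x y) (Word.comp k n x' y') := by
  induction n generalizing k l X with
  | zero => exact (not_composable_zero hx).elim
  | succ n ih =>
    cases l with
    | zero => exact absurd hkl (Nat.not_lt_zero _)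
    | succ l =>
      cases k with
      | zero => exact Prod.ext rfl (List.zipWith_append hx.2.length_eq).symm
      | succ k =>
        refine Prod.ext rfl ?_
        obtain ⟨a, l⟩ := x
        obtain ⟨a', l'⟩ := x'
        obtain ⟨b, m⟩ := y
        obtain ⟨b', m'⟩ := y'
        simp only [Word.comp]
        have h2 : List.Forall₂ _ l l' := hx.2
        clear hx
        induction h2 generalizing m m' with
        | nil => simp
        | cons h _ ihl =>
          cases m <;> cases m' <;>
            simp [ihl, ih (Nat.lt_of_succ_lt_succ hkl) (X := X.shift) h]

theorem idn_interchange {k n : ℕ} (h : k < n) {X : GlobularSet.{u}} (x y : Word n X) :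
    Word.comp k (n + 1) (Word.idn n x) (Word.idn n y) = Word.idn n (Word.comp k n x y) := by
  induction n generalizing k X with
  | zero => exact absurd h (Nat.not_lt_zero _)
  | succ n ih =>
    cases k with
    | zero => exact Prod.ext rfl List.map_append.symm
    | succ k =>
      refine Prod.ext rfl ?_
      simp only [Word.idn, Word.comp, List.map_zipWith, List.zipWith_map]
      congr 1
      funext y z
      exact ih (Nat.lt_of_succ_lt_succ h) (X := X.shift) y z

end Word

/-! ### The free strict ω-category -/

/-- The globular set of valid words. -/
def words (X : GlobularSet.{u}) : GlobularSet.{u} where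
  cells n := { x : Word n X // x.Valid n }
  src x := ⟨x.1.src _, x.2.src⟩
  tgt x := ⟨x.1.tgt _, x.2.tgt⟩
  src_src x := Subtype.ext (Word.src_src x.1)
  tgt_tgt x := Subtype.ext (Word.tgt_tgt x.1 x.2)

theorem words_srcTo (X : GlobularSet.{u}) {k n : ℕ} (h : k ≤ n) (x : X.words.cells n) :
    (X.words.srcTo h x).1 = Word.srcTo k n h x.1 := by
  induction n, h using Nat.le_induction with
  | base => simp [srcTo, Nat.leRecOn_self, Word.srcTo_self]
  | succ m h ih =>
    simp only [srcTo, Nat.leRecOn_succ h] at ih ⊢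
    rw [ih, ← Word.srcTo_src]
    rfl

theorem words_tgtTo (X : GlobularSet.{u}) {k n : ℕ} (h : k ≤ n) (x : X.words.cells n) :
    (X.words.tgtTo h x).1 = Word.tgtTo k n h x.1 := by
  induction n, h using Nat.le_induction with
  | base => simp [tgtTo, Nat.leRecOn_self, Word.tgtTo_self]
  | succ m h ih =>
    simp only [tgtTo, Nat.leRecOn_succ h] at ih ⊢
    rw [ih, ← Word.tgtTo_tgt]
    rfl

/-- The identity on a valid word. -/
def wordsIdn (X : GlobularSet.{u}) {n : ℕ} (x : X.words.cells n) : X.words.cells (n + 1) :=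
  ⟨x.1.idn _, x.2.idn⟩

theorem words_idnTo (X : GlobularSet.{u}) {k n : ℕ} (h : k ≤ n) (x : X.words.cells k) :
    (Nat.leRecOn (C := X.words.cells) h (fun {n} x => X.wordsIdn (n := n) x) x).1 =
      Word.idnTo k n h x.1 := by
  induction n, h using Nat.le_induction with
  | base => simp [Nat.leRecOn_self, Word.idnTo_self]
  | succ m h ih =>
    rw [Nat.leRecOn_succ h, ← Word.idn_idnTo h, ← ih]
    rfl

theorem words_composable {X : GlobularSet.{u}} {k n : ℕ} (h : k < n) {x y : X.words.cells n}
    (hxy : X.words.tgtTo h.le x = X.words.srcTo h.le y) : Word.Composable k n x.1 y.1 :=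
  Word.composable_of_eq h (by rw [← words_tgtTo, ← words_srcTo, hxy])

/-- The free strict `ω`-category on a globular set. -/
def free (X : GlobularSet.{u}) : StrictOmegaCat.{u} where
  toGlobularSet := X.words
  idn := X.wordsIdn
  comp {k n} h x y hxy := ⟨Word.comp k n x.1 y.1, x.2.comp y.2 (words_composable h hxy)⟩
  src_idn x := Subtype.ext (Word.src_idn x.1)
  tgt_idn x := Subtype.ext (Word.tgt_idn x.1)
  src_comp_top {n} x y hxy := Subtype.ext (Word.src_comp_top (words_composable n.lt_succ_self hxy))
  tgt_comp_top {n} x y hxy := Subtype.ext (Word.tgt_comp_top (words_composable n.lt_succ_self hxy))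
  src_comp h x y _ _ := Subtype.ext (Word.src_comp h x.1 y.1)
  tgt_comp h x y _ _ := Subtype.ext (Word.tgt_comp h x.1 y.1)
  assoc h x y z _ _ _ _ := Subtype.ext (Word.comp_assoc x.1 y.1 z.1)
  idn_comp {k n} h x _ := Subtype.ext (by
    change Word.comp k n _ _ = _
    rw [words_idnTo, words_srcTo, Word.idnTo_comp h])
  comp_idn {k n} h x _ := Subtype.ext (by
    change Word.comp k n _ _ = _
    rw [words_idnTo, words_tgtTo, Word.comp_idnTo h])
  interchange hkl hln x x' y y' hx _ _ _ _ _ :=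
    Subtype.ext (Word.interchange hkl (words_composable hln hx))
  idn_interchange h x y _ _ := Subtype.ext (Word.idn_interchange h x.1 y.1)

end GlobularSet

/-! ### Iterated sources and targets -/

namespace GlobularSet

variable (X : GlobularSet.{u})

theorem srcTo_self {n : ℕ} (x : X.cells n) : X.srcTo le_rfl x = x := by
  simp [srcTo, Nat.leRecOn_self]

theorem tgtTo_self {n : ℕ} (x : X.cells n) : X.tgtTo le_rfl x = x := by
  simp [tgtTo, Nat.leRecOn_self]

theorem srcTo_succ {k n : ℕ} (h : k ≤ n) (x : X.cells (n + 1)) :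
    X.srcTo (Nat.le_succ_of_le h) x = X.srcTo h (X.src x) := by
  simp only [srcTo, Nat.leRecOn_succ h]

theorem tgtTo_succ {k n : ℕ} (h : k ≤ n) (x : X.cells (n + 1)) :
    X.tgtTo (Nat.le_succ_of_le h) x = X.tgtTo h (X.tgt x) := by
  simp only [tgtTo, Nat.leRecOn_succ h]

theorem src_srcTo {k n : ℕ} (h : k + 1 ≤ n) (x : X.cells n) :
    X.src (X.srcTo h x) = X.srcTo (Nat.le_of_succ_le h) x := by
  induction n, h using Nat.le_induction with
  | base => rw [srcTo_self, X.srcTo_succ le_rfl, srcTo_self]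
  | succ m h ih => rw [X.srcTo_succ h, ih, X.srcTo_succ (Nat.le_of_succ_le h)]

theorem tgt_tgtTo {k n : ℕ} (h : k + 1 ≤ n) (x : X.cells n) :
    X.tgt (X.tgtTo h x) = X.tgtTo (Nat.le_of_succ_le h) x := by
  induction n, h using Nat.le_induction with
  | base => rw [tgtTo_self, X.tgtTo_succ le_rfl, tgtTo_self]
  | succ m h ih => rw [X.tgtTo_succ h, ih, X.tgtTo_succ (Nat.le_of_succ_le h)]

theorem srcTo_tgt {k n : ℕ} (h : k < n) (x : X.cells (n + 1)) :
    X.srcTo h.le (X.tgt x) = X.srcTo (Nat.le_succ_of_le h.le) x := by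
  obtain ⟨n, rfl⟩ : ∃ m, n = m + 1 := ⟨n - 1, by omega⟩
  have h' : k ≤ n := Nat.le_of_lt_succ h
  rw [X.srcTo_succ h', ← src_src, ← X.srcTo_succ h', ← X.srcTo_succ h.le]

theorem tgtTo_src {k n : ℕ} (h : k < n) (x : X.cells (n + 1)) :
    X.tgtTo h.le (X.src x) = X.tgtTo (Nat.le_succ_of_le h.le) x := by
  obtain ⟨n, rfl⟩ : ∃ m, n = m + 1 := ⟨n - 1, by omega⟩
  have h' : k ≤ n := Nat.le_of_lt_succ h
  rw [X.tgtTo_succ h', tgt_tgt, ← X.tgtTo_succ h', ← X.tgtTo_succ h.le]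

theorem srcTo_srcTo {j k n : ℕ} (hjk : j ≤ k) (hkn : k ≤ n) (x : X.cells n) :
    X.srcTo hjk (X.srcTo hkn x) = X.srcTo (hjk.trans hkn) x := by
  induction n, hkn using Nat.le_induction with
  | base => rw [srcTo_self]
  | succ m h ih => rw [X.srcTo_succ h, ih, X.srcTo_succ (hjk.trans h)]

theorem tgtTo_tgtTo {j k n : ℕ} (hjk : j ≤ k) (hkn : k ≤ n) (x : X.cells n) :
    X.tgtTo hjk (X.tgtTo hkn x) = X.tgtTo (hjk.trans hkn) x := by
  induction n, hkn using Nat.le_induction with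
  | base => rw [tgtTo_self]
  | succ m h ih => rw [X.tgtTo_succ h, ih, X.tgtTo_succ (hjk.trans h)]

theorem tgtTo_srcTo {j k n : ℕ} (hjk : j < k) (hkn : k ≤ n) (x : X.cells n) :
    X.tgtTo hjk.le (X.srcTo hkn x) = X.tgtTo (hjk.le.trans hkn) x := by
  induction n, hkn using Nat.le_induction with
  | base => rw [srcTo_self]
  | succ m h ih => rw [X.srcTo_succ h, ih, X.tgtTo_src (hjk.trans_le h)]

theorem shift_srcTo {k n : ℕ} (h : k ≤ n) (x : X.cells (n + 1)) :
    X.shift.srcTo h x = X.srcTo (Nat.succ_le_succ h) x := by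
  induction n, h using Nat.le_induction with
  | base => exact (X.shift.srcTo_self x).trans (X.srcTo_self x).symm
  | succ m h ih =>
    exact (X.shift.srcTo_succ h x).trans
      ((ih (X.src x)).trans (X.srcTo_succ (Nat.succ_le_succ h) x).symm)

theorem shift_tgtTo {k n : ℕ} (h : k ≤ n) (x : X.cells (n + 1)) :
    X.shift.tgtTo h x = X.tgtTo (Nat.succ_le_succ h) x := by
  induction n, h using Nat.le_induction with
  | base => exact (X.shift.tgtTo_self x).trans (X.tgtTo_self x).symm
  | succ m h ih =>
    exact (X.shift.tgtTo_succ h x).trans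
      ((ih (X.tgt x)).trans (X.tgtTo_succ (Nat.succ_le_succ h) x).symm)

variable {X}

/-- The map induced on cells of positive dimension. -/
def Hom.shift {Y : GlobularSet.{u}} (f : Hom X Y) : Hom X.shift Y.shift where
  app n := f.app (n + 1)
  app_src := f.app_src
  app_tgt := f.app_tgt

end GlobularSet

/-! ### Shifting a strict ω-category and composing paths along dimension 0 -/

namespace StrictOmegaCat

variable (C : StrictOmegaCat.{u})

theorem comp_congr {k n : ℕ} (h : k < n) {x x' y y' : C.cells n} (hx : x = x') (hy : y = y')
    (hxy) (hxy') : C.comp h x y hxy = C.comp h x' y' hxy' := by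
  subst hx hy
  rfl

theorem srcTo_comp_self {k n : ℕ} (h : k < n) (x y : C.cells n) (hxy) :
    C.srcTo h.le (C.comp h x y hxy) = C.srcTo h.le x := by
  induction n with
  | zero => exact absurd h (Nat.not_lt_zero _)
  | succ n ih =>
    rcases Nat.lt_succ_iff_lt_or_eq.1 h with h' | rfl
    · rw [C.srcTo_succ h'.le, C.srcTo_succ h'.le, C.src_comp h', ih h']
      rw [C.tgtTo_src h', ← C.srcTo_succ h'.le, hxy]
    · rw [C.srcTo_succ le_rfl, C.srcTo_succ le_rfl, C.src_comp_top]

theorem tgtTo_comp_self {k n : ℕ} (h : k < n) (x y : C.cells n) (hxy) :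
    C.tgtTo h.le (C.comp h x y hxy) = C.tgtTo h.le y := by
  induction n with
  | zero => exact absurd h (Nat.not_lt_zero _)
  | succ n ih =>
    rcases Nat.lt_succ_iff_lt_or_eq.1 h with h' | rfl
    · rw [C.tgtTo_succ h'.le, C.tgtTo_succ h'.le, C.tgt_comp h', ih h']
      rw [C.srcTo_tgt h', ← C.tgtTo_succ h'.le, hxy]
    · rw [C.tgtTo_succ le_rfl, C.tgtTo_succ le_rfl, C.tgt_comp_top]

/-- The iterated identity. -/
def idnTo {k n : ℕ} (h : k ≤ n) : C.cells k → C.cells n :=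
  Nat.leRecOn h C.idn

theorem idnTo_self {n : ℕ} (x : C.cells n) : C.idnTo le_rfl x = x :=
  Nat.leRecOn_self _

theorem idnTo_succ {k n : ℕ} (h : k ≤ n) (x : C.cells k) :
    C.idnTo (Nat.le_succ_of_le h) x = C.idn (C.idnTo h x) :=
  Nat.leRecOn_succ h _

theorem srcTo_idnTo {j k n : ℕ} (hjk : j ≤ k) (hkn : k ≤ n) (x : C.cells j) :
    C.srcTo hkn (C.idnTo (hjk.trans hkn) x) = C.idnTo hjk x := by
  induction n, hkn using Nat.le_induction with
  | base => rw [C.srcTo_self]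
  | succ m h ih => rw [C.idnTo_succ (hjk.trans h), C.srcTo_succ h, C.src_idn, ih]

theorem tgtTo_idnTo {j k n : ℕ} (hjk : j ≤ k) (hkn : k ≤ n) (x : C.cells j) :
    C.tgtTo hkn (C.idnTo (hjk.trans hkn) x) = C.idnTo hjk x := by
  induction n, hkn using Nat.le_induction with
  | base => rw [C.tgtTo_self]
  | succ m h ih => rw [C.idnTo_succ (hjk.trans h), C.tgtTo_succ h, C.tgt_idn, ih]

theorem idnTo_idnTo {j k n : ℕ} (hjk : j ≤ k) (hkn : k ≤ n) (x : C.cells j) :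
    C.idnTo hkn (C.idnTo hjk x) = C.idnTo (hjk.trans hkn) x := by
  induction n, hkn using Nat.le_induction with
  | base => rw [C.idnTo_self]
  | succ m h ih => rw [C.idnTo_succ h, ih, C.idnTo_succ (hjk.trans h)]

theorem idnTo_shift {k n : ℕ} (h : k ≤ n) (x : C.cells (k + 1)) :
    Nat.leRecOn (C := C.toGlobularSet.shift.cells) h C.idn x = C.idnTo (Nat.succ_le_succ h) x := by
  induction n, h using Nat.le_induction with
  | base => exact (Nat.leRecOn_self _).trans (C.idnTo_self x).symm
  | succ m h ih =>
    exact (Nat.leRecOn_succ h _).trans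
      ((congrArg C.idn ih).trans (C.idnTo_succ (Nat.succ_le_succ h) x).symm)

/-- The strict `ω`-category of cells of positive dimension: the disjoint union of all hom
`ω`-categories. -/
def shift : StrictOmegaCat.{u} where
  toGlobularSet := C.toGlobularSet.shift
  idn := C.idn
  comp h x y hxy := C.comp (Nat.succ_lt_succ h) x y
    ((C.toGlobularSet.shift_tgtTo h.le x).symm.trans
      (hxy.trans (C.toGlobularSet.shift_srcTo h.le y)))
  src_idn := C.src_idn
  tgt_idn := C.tgt_idn
  src_comp_top x y _ := C.src_comp_top x y _
  tgt_comp_top x y _ := C.tgt_comp_top x y _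
  src_comp h x y _ _ := C.src_comp (Nat.succ_lt_succ h) x y _ _
  tgt_comp h x y _ _ := C.tgt_comp (Nat.succ_lt_succ h) x y _ _
  assoc h x y z _ _ _ _ := C.assoc (Nat.succ_lt_succ h) x y z _ _ _ _
  idn_comp {k n} h x hx := by
    -- Iterated sources and identities of the shift are recursions over a different range of
    -- dimensions, so they agree with those of `C` only propositionally; the composite is rewritten
    -- along this before the unit law of `C` applies.
    have e := (C.idnTo_shift h.le (C.toGlobularSet.shift.srcTo h.le x)).trans
      (congrArg _ (C.toGlobularSet.shift_srcTo h.le x))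
    refine (C.comp_congr (Nat.succ_lt_succ h) e rfl _ ?_).trans
      (C.idn_comp (Nat.succ_lt_succ h) x ?_)
    all_goals exact C.tgtTo_idnTo le_rfl _ _ |>.trans (C.idnTo_self _)
  comp_idn {k n} h x hx := by
    have e := (C.idnTo_shift h.le (C.toGlobularSet.shift.tgtTo h.le x)).trans
      (congrArg _ (C.toGlobularSet.shift_tgtTo h.le x))
    refine (C.comp_congr (Nat.succ_lt_succ h) rfl e _ ?_).trans
      (C.comp_idn (Nat.succ_lt_succ h) x ?_)
    all_goals exact (C.srcTo_idnTo le_rfl _ _ |>.trans (C.idnTo_self _)).symm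
  interchange hkl hln x x' y y' _ _ _ _ _ _ :=
    C.interchange (Nat.succ_lt_succ hkl) (Nat.succ_lt_succ hln) x x' y y' _ _ _ _ _ _
  idn_interchange h x y _ _ := C.idn_interchange (Nat.succ_lt_succ h) x y _ _

open Classical in
/-- Composition, extended by a default value to all pairs of cells. -/
noncomputable def tcomp {k n : ℕ} (h : k < n) (x y : C.cells n) : C.cells n :=
  if hxy : C.tgtTo h.le x = C.srcTo h.le y then C.comp h x y hxy else x

theorem tcomp_eq {k n : ℕ} (h : k < n) {x y : C.cells n} (hxy) :
    C.tcomp h x y = C.comp h x y hxy :=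
  dif_pos hxy

theorem tcomp_eq_left {k n : ℕ} (h : k < n) {x y : C.cells n}
    (hxy : ¬ C.tgtTo h.le x = C.srcTo h.le y) : C.tcomp h x y = x :=
  dif_neg hxy

theorem shift_tcomp {k n : ℕ} (h : k < n) (x y : C.cells (n + 1)) :
    C.shift.tcomp h x y = C.tcomp (Nat.succ_lt_succ h) x y := by
  have e1 := C.toGlobularSet.shift_tgtTo h.le x
  have e2 := C.toGlobularSet.shift_srcTo h.le y
  by_cases hxy : C.tgtTo (Nat.succ_lt_succ h).le x = C.srcTo (Nat.succ_lt_succ h).le y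
  · exact (C.shift.tcomp_eq h (e1.trans (hxy.trans e2.symm))).trans
      (C.tcomp_eq (Nat.succ_lt_succ h) hxy).symm
  · exact (C.shift.tcomp_eq_left h fun h' => hxy (e1.symm.trans (Eq.trans h' e2))).trans
      (C.tcomp_eq_left (Nat.succ_lt_succ h) hxy).symm

/-- The composite along dimension zero of a sequence of cells. -/
noncomputable def pathComp {n : ℕ} : C.cells 0 → List (C.cells (n + 1)) → C.cells (n + 1)
  | a, [] => C.idnTo (Nat.zero_le _) a
  | _, x :: l =>
    C.tcomp n.succ_pos x (pathComp (C.tgtTo (Nat.zero_le _) x) l)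

/-- The cells in a list can be composed along dimension zero. -/
abbrev IsCellPath {n : ℕ} (a : C.cells 0) (l : List (C.cells n)) : Prop :=
  IsPath (C.srcTo n.zero_le) (C.tgtTo n.zero_le) a l

variable {C} {n : ℕ} {a : C.cells 0} {l m : List (C.cells (n + 1))}

/-- This makes the head of a path composable with the composite of its tail, so along a path the
total operation `tcomp` never takes its default value. -/
theorem IsCellPath.srcTo_pathComp (h : C.IsCellPath a l) :
    C.srcTo (Nat.zero_le _) (C.pathComp a l) = a := by
  induction l generalizing a with
  | nil => exact (C.srcTo_idnTo le_rfl _ a).trans (C.idnTo_self a)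
  | cons x l ih =>
    rw [pathComp, C.tcomp_eq n.succ_pos (ih h.2).symm, srcTo_comp_self]
    exact h.1

theorem IsCellPath.tgtTo_eq {x : C.cells (n + 1)} (h : C.IsCellPath a (x :: l)) :
    C.tgtTo (Nat.zero_le _) x =
      C.srcTo (Nat.zero_le _) (C.pathComp (C.tgtTo (Nat.zero_le _) x) l) :=
  (IsCellPath.srcTo_pathComp h.2).symm

theorem IsCellPath.pathComp_cons {x : C.cells (n + 1)} (h : C.IsCellPath a (x :: l)) :
    C.pathComp a (x :: l) =
      C.comp n.succ_pos x (C.pathComp (C.tgtTo (Nat.zero_le _) x) l) h.tgtTo_eq :=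
  C.tcomp_eq _ _

theorem IsCellPath.tgtTo_pathComp (h : C.IsCellPath a l) :
    C.tgtTo (Nat.zero_le _) (C.pathComp a l) = pathEnd (C.tgtTo (Nat.zero_le _)) a l := by
  induction l generalizing a with
  | nil => exact (C.tgtTo_idnTo le_rfl _ a).trans (C.idnTo_self a)
  | cons x l ih =>
    rw [h.pathComp_cons, tgtTo_comp_self]
    exact ih h.2

/-- The empty path is the left unit law, and prepending a cell is associativity. -/
theorem IsCellPath.pathComp_append (h : C.IsCellPath a (l ++ m)) :
    C.pathComp a (l ++ m) =
      C.tcomp n.succ_pos (C.pathComp a l) (C.pathComp (pathEnd (C.tgtTo (Nat.zero_le _)) a l) m) := by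
  obtain ⟨hl, hm⟩ : C.IsCellPath a l ∧
    C.IsCellPath (pathEnd (C.tgtTo (Nat.zero_le _)) a l) m := isPath_append.1 h
  rw [C.tcomp_eq n.succ_pos (hl.tgtTo_pathComp.trans (IsCellPath.srcTo_pathComp hm).symm)]
  induction l generalizing a with
  | nil =>
    have e := IsCellPath.srcTo_pathComp hm
    refine (C.idn_comp n.succ_pos _ ?_).symm.trans (C.comp_congr _ ?_ rfl _ _)
    · exact (C.tgtTo_idnTo le_rfl _ _).trans (C.idnTo_self _)
    · exact congrArg (C.idnTo (Nat.zero_le (n + 1))) e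
  | cons x l ih =>
    have h' : C.IsCellPath a (x :: (l ++ m)) := h
    have e := hl.tgtTo_pathComp.trans (IsCellPath.srcTo_pathComp hm).symm
    have e' := (IsCellPath.tgtTo_pathComp hl.2).trans (IsCellPath.srcTo_pathComp hm).symm
    have e1 : C.tgtTo n.succ_pos.le x = C.srcTo n.succ_pos.le (C.comp n.succ_pos _ _ e') :=
      hl.tgtTo_eq.trans (C.srcTo_comp_self _ _ _ _).symm
    refine h'.pathComp_cons.trans ?_
    refine (C.comp_congr _ rfl (ih h.2 hl.2 hm) _ e1).trans ?_
    refine (C.assoc n.succ_pos _ _ _ hl.tgtTo_eq _ ((C.tgtTo_comp_self _ _ _ _).trans e') _).symm.trans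
      (C.comp_congr _ hl.pathComp_cons.symm rfl _ _)

theorem IsCellPath.src {l : List (C.cells (n + 2))} (h : C.IsCellPath a l) :
    C.IsCellPath a (l.map C.src) := by
  refine (isPath_map _ _ _).2 ((isPath_congr (fun x _ => ?_) fun x _ => ?_).1 h)
  · exact C.srcTo_succ (Nat.zero_le _) x
  · exact (C.tgtTo_src n.succ_pos x).symm

theorem IsCellPath.tgt {l : List (C.cells (n + 2))} (h : C.IsCellPath a l) :
    C.IsCellPath a (l.map C.tgt) := by
  refine (isPath_map _ _ _).2 ((isPath_congr (fun x _ => ?_) fun x _ => ?_).1 h)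
  · exact (C.srcTo_tgt n.succ_pos x).symm
  · exact C.tgtTo_succ (Nat.zero_le _) x

theorem IsCellPath.idn (h : C.IsCellPath a l) : C.IsCellPath a (l.map C.idn) := by
  refine (isPath_map _ _ _).2 ((isPath_congr (fun x _ => ?_) fun x _ => ?_).1 h)
  · rw [C.srcTo_succ (Nat.zero_le _) (C.idn x), C.src_idn]
  · rw [C.tgtTo_succ (Nat.zero_le _) (C.idn x), C.tgt_idn]

/-- The cells have dimension at least 2, so composition along dimension 0 is not the top one and
taking sources distributes over it. -/
theorem IsCellPath.src_pathComp {l : List (C.cells (n + 2))} (h : C.IsCellPath a l) :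
    C.src (C.pathComp a l) = C.pathComp a (l.map C.src) := by
  induction l generalizing a with
  | nil => exact (congrArg C.src (C.idnTo_succ (Nat.zero_le _) a)).trans (C.src_idn _)
  | cons x l ih =>
    have e := C.tgtTo_src n.succ_pos x
    have e' : C.pathComp (C.tgtTo (Nat.zero_le _) (C.src x)) (l.map C.src) =
        C.src (C.pathComp (C.tgtTo (Nat.zero_le _) x) l) := by rw [e, ih h.2]
    rw [h.pathComp_cons, List.map_cons, IsCellPath.pathComp_cons h.src]
    refine (C.src_comp n.succ_pos _ _ _ ?_).trans (C.comp_congr _ rfl e'.symm _ _)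
    exact (IsCellPath.tgtTo_eq h.src).trans (congrArg _ e')

theorem IsCellPath.tgt_pathComp {l : List (C.cells (n + 2))} (h : C.IsCellPath a l) :
    C.tgt (C.pathComp a l) = C.pathComp a (l.map C.tgt) := by
  induction l generalizing a with
  | nil => exact (congrArg C.tgt (C.idnTo_succ (Nat.zero_le _) a)).trans (C.tgt_idn _)
  | cons x l ih =>
    have e := (C.tgtTo_succ (Nat.zero_le (n + 1)) x).symm
    have e' : C.pathComp (C.tgtTo (Nat.zero_le _) (C.tgt x)) (l.map C.tgt) =
        C.tgt (C.pathComp (C.tgtTo (Nat.zero_le _) x) l) := by rw [e, ih h.2]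
    rw [h.pathComp_cons, List.map_cons, IsCellPath.pathComp_cons h.tgt]
    refine (C.tgt_comp n.succ_pos _ _ _ ?_).trans (C.comp_congr _ rfl e'.symm _ _)
    exact (IsCellPath.tgtTo_eq h.tgt).trans (congrArg _ e')

/-- This is nullary interchange, iterated along the path. -/
theorem IsCellPath.idn_pathComp (h : C.IsCellPath a l) :
    C.idn (C.pathComp a l) = C.pathComp a (l.map C.idn) := by
  induction l generalizing a with
  | nil => exact (C.idnTo_succ (Nat.zero_le _) a).symm
  | cons x l ih =>
    have e : C.tgtTo (Nat.zero_le _) (C.idn x) = C.tgtTo (Nat.zero_le _) x := by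
      rw [C.tgtTo_succ (Nat.zero_le _), C.tgt_idn]
    have e' : C.pathComp (C.tgtTo (Nat.zero_le _) (C.idn x)) (l.map C.idn) =
        C.idn (C.pathComp (C.tgtTo (Nat.zero_le _) x) l) := by rw [e, ih h.2]
    rw [h.pathComp_cons, List.map_cons, IsCellPath.pathComp_cons h.idn]
    refine (C.idn_interchange n.succ_pos _ _ _ ?_).symm.trans (C.comp_congr _ rfl e'.symm _ _)
    exact (IsCellPath.tgtTo_eq h.idn).trans (congrArg _ e')

theorem IsCellPath.srcTo_map {k : ℕ} (hk : k ≤ n) (h : C.IsCellPath a l) :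
    C.srcTo (Nat.succ_le_succ hk) (C.pathComp a l) =
      C.pathComp a (l.map (C.srcTo (Nat.succ_le_succ hk))) := by
  induction n, hk using Nat.le_induction with
  | base =>
    rw [C.srcTo_self]
    congr 1
    exact ((List.map_congr_left fun x _ => C.srcTo_self x).trans (List.map_id _)).symm
  | succ n hk ih =>
    rw [C.srcTo_succ (Nat.succ_le_succ hk), h.src_pathComp, ih h.src, List.map_map]
    congr 1
    exact List.map_congr_left fun x _ => (C.srcTo_succ (Nat.succ_le_succ hk) x).symm

theorem IsCellPath.tgtTo_map {k : ℕ} (hk : k ≤ n) (h : C.IsCellPath a l) :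
    C.tgtTo (Nat.succ_le_succ hk) (C.pathComp a l) =
      C.pathComp a (l.map (C.tgtTo (Nat.succ_le_succ hk))) := by
  induction n, hk using Nat.le_induction with
  | base =>
    rw [C.tgtTo_self]
    congr 1
    exact ((List.map_congr_left fun x _ => C.tgtTo_self x).trans (List.map_id _)).symm
  | succ n hk ih =>
    rw [C.tgtTo_succ (Nat.succ_le_succ hk), h.tgt_pathComp, ih h.tgt, List.map_map]
    congr 1
    exact List.map_congr_left fun x _ => (C.tgtTo_succ (Nat.succ_le_succ hk) x).symm

theorem srcTo_tcomp_of_lt {j k n : ℕ} (hjk : j < k) (hkn : k < n) {x y : C.cells n}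
    (hxy : C.tgtTo hkn.le x = C.srcTo hkn.le y) :
    C.srcTo (hjk.trans hkn).le (C.tcomp hkn x y) = C.srcTo (hjk.trans hkn).le x := by
  rw [C.tcomp_eq hkn hxy, ← C.srcTo_srcTo hjk.le hkn.le, C.srcTo_comp_self,
    C.srcTo_srcTo hjk.le hkn.le]

/-- By globularity, cells composable along dimension `k` share all boundaries of dimension below
`k`. For `j = 0` this lets two paths composable entry by entry pass through the same vertices. -/
theorem tgtTo_eq_of_lt {j k n : ℕ} (hjk : j < k) (hkn : k < n) {x y : C.cells n}
    (hxy : C.tgtTo hkn.le x = C.srcTo hkn.le y) :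
    C.tgtTo (hjk.trans hkn).le x = C.tgtTo (hjk.trans hkn).le y := by
  rw [← C.tgtTo_tgtTo hjk.le hkn.le, hxy, C.tgtTo_srcTo hjk hkn.le]

theorem tgtTo_tcomp_of_lt {j k n : ℕ} (hjk : j < k) (hkn : k < n) {x y : C.cells n}
    (hxy : C.tgtTo hkn.le x = C.srcTo hkn.le y) :
    C.tgtTo (hjk.trans hkn).le (C.tcomp hkn x y) = C.tgtTo (hjk.trans hkn).le x := by
  rw [C.tcomp_eq hkn hxy, ← C.tgtTo_tgtTo hjk.le hkn.le, C.tgtTo_comp_self,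
    C.tgtTo_tgtTo hjk.le hkn.le, tgtTo_eq_of_lt hjk hkn hxy]

theorem IsCellPath.composable {k : ℕ} (hk : k < n) (hl : C.IsCellPath a l)
    (hm : C.IsCellPath a m) (h : List.Forall₂ (fun x y =>
      C.tgtTo (Nat.succ_lt_succ hk).le x = C.srcTo (Nat.succ_lt_succ hk).le y) l m) :
    C.tgtTo (Nat.succ_lt_succ hk).le (C.pathComp a l) =
      C.srcTo (Nat.succ_lt_succ hk).le (C.pathComp a m) := by
  rw [hl.tgtTo_map hk.le, hm.srcTo_map hk.le]
  congr 1
  rw [← List.forall₂_eq_eq_eq, List.forall₂_map_left_iff, List.forall₂_map_right_iff]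
  exact h

theorem IsCellPath.zipWith {k : ℕ} (hk : k < n) (hl : C.IsCellPath a l)
    (h : List.Forall₂ (fun x y =>
      C.tgtTo (Nat.succ_lt_succ hk).le x = C.srcTo (Nat.succ_lt_succ hk).le y) l m) :
    C.IsCellPath a (List.zipWith (C.tcomp (Nat.succ_lt_succ hk)) l m) := by
  induction h generalizing a with
  | nil => trivial
  | cons h _ ih =>
    refine ⟨(srcTo_tcomp_of_lt k.succ_pos (Nat.succ_lt_succ hk) h).trans hl.1, ?_⟩
    have e := tgtTo_tcomp_of_lt k.succ_pos (Nat.succ_lt_succ hk) h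
    rw [e]
    exact ih hl.2

/-- Binary interchange between dimension 0 and dimension `k + 1`, iterated along two parallel paths.
The rest of the argument aligns the intermediate 0-cells, which agree only up to the equalities `e`
and `e'`. -/
theorem IsCellPath.pathComp_zipWith {k : ℕ} (hk : k < n) (hl : C.IsCellPath a l)
    (hm : C.IsCellPath a m) (h : List.Forall₂ (fun x y =>
      C.tgtTo (Nat.succ_lt_succ hk).le x = C.srcTo (Nat.succ_lt_succ hk).le y) l m) :
    C.pathComp a (List.zipWith (C.tcomp (Nat.succ_lt_succ hk)) l m) =
      C.tcomp (Nat.succ_lt_succ hk) (C.pathComp a l) (C.pathComp a m) := by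
  have hz := hl.zipWith hk h
  rw [C.tcomp_eq _ (hl.composable hk hm h)]
  induction h generalizing a with
  | nil =>
    -- The composite of the empty path is an iterated identity on a 0-cell, hence also the identity
    -- on its own `(k+1)`-dimensional source; the unit law shows that it composes with itself to
    -- itself.
    have e : C.idnTo (Nat.succ_lt_succ hk).le (C.srcTo (Nat.succ_lt_succ hk).le
        (C.idnTo (Nat.zero_le (n + 1)) a)) = C.idnTo (Nat.zero_le (n + 1)) a := by
      rw [C.srcTo_idnTo (Nat.zero_le _) (Nat.succ_lt_succ hk).le, C.idnTo_idnTo]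
    refine (C.idn_comp (Nat.succ_lt_succ hk) _ ?_).symm.trans (C.comp_congr _ e rfl _ _)
    exact (C.tgtTo_idnTo le_rfl _ _).trans (C.idnTo_self _)
  | @cons x y l m h hlm ih =>
    have e := tgtTo_tcomp_of_lt k.succ_pos (Nat.succ_lt_succ hk) h
    have e' := tgtTo_eq_of_lt k.succ_pos (Nat.succ_lt_succ hk) h
    have hm' : C.IsCellPath (C.tgtTo (Nat.zero_le _) x) m := by rw [e']; exact hm.2
    have hz' : C.IsCellPath (C.tgtTo (Nat.zero_le _) x)
      (List.zipWith (C.tcomp (Nat.succ_lt_succ hk)) l m) := IsCellPath.zipWith hk hl.2 hlm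
    have hc := IsCellPath.composable hk hl.2 hm' hlm
    have hxy := tcomp_eq C (Nat.succ_lt_succ hk) h
    have key := ih hl.2 hm' hz'
    have hx := hl.tgtTo_eq
    have hy := hm.tgtTo_eq
    have e1 : C.pathComp (C.tgtTo (Nat.zero_le _) (C.tcomp (Nat.succ_lt_succ hk) x y))
        (List.zipWith (C.tcomp (Nat.succ_lt_succ hk)) l m) = _ :=
      (congrArg (fun b => C.pathComp b _) e).trans key
    have e2 : C.pathComp (C.tgtTo (Nat.zero_le _) y) m =
      C.pathComp (C.tgtTo (Nat.zero_le _) x) m := congrArg (fun b => C.pathComp b m) e'.symm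
    have hz0 := IsCellPath.tgtTo_eq (l := List.zipWith (C.tcomp (Nat.succ_lt_succ hk)) l m) hz
    refine (IsCellPath.pathComp_cons hz).trans ?_
    refine (C.comp_congr _ hxy e1 _ (by rw [← hxy, ← e1]; exact hz0)).trans ?_
    refine (C.interchange k.succ_pos (Nat.succ_lt_succ hk) x y _ _ h hc hx (by rw [← e2]; exact hy)
      _ (by
        rw [← hl.pathComp_cons, ← C.comp_congr _ rfl e2 hy, ← hm.pathComp_cons]
        exact hl.composable hk hm (.cons h hlm))).trans ?_
    exact C.comp_congr _ hl.pathComp_cons.symm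
      ((C.comp_congr _ rfl e2.symm _ _).trans hm.pathComp_cons.symm) _ _

end StrictOmegaCat

/-! ### Evaluation of words in a strict ω-category -/

theorem map_zipWith_of_forall₂ {α β : Type*} {g : α → β} {c : α → α → α} {d : β → β → β}
    {l m : List α} (h : List.Forall₂ (fun y z => g (c y z) = d (g y) (g z)) l m) :
    List.map g (List.zipWith c l m) = List.zipWith d (List.map g l) (List.map g m) := by
  induction h with
  | nil => rfl
  | cons h _ ih => simp only [List.zipWith_cons_cons, List.map_cons, h, ih]

theorem forall₂_and_of_forall_mem {α : Type*} {R : α → α → Prop} {P : α → Prop} {l m : List α}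
    (h : List.Forall₂ R l m) (hl : ∀ y ∈ l, P y) (hm : ∀ z ∈ m, P z) :
    List.Forall₂ (fun y z => P y ∧ P z ∧ R y z) l m := by
  induction h with
  | nil => exact .nil
  | cons h _ ih =>
    simp only [List.mem_cons, forall_eq_or_imp] at hl hm
    exact .cons ⟨hl.1, hm.1, h⟩ (ih hl.2 hm.2)

namespace GlobularSet

namespace Word

theorem tgtTo_eq_of_composable {k n : ℕ} (h : k < n) {X : GlobularSet.{u}} {x y : Word n X}
    (hxy : Composable k n x y) : tgtTo k n h.le x = srcTo k n h.le y := by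
  induction n generalizing k X with
  | zero => exact absurd h (Nat.not_lt_zero _)
  | succ n ih =>
    cases k with
    | zero => exact hxy
    | succ k =>
      refine Prod.ext hxy.1 ?_
      change List.map (tgtTo k n (Nat.lt_of_succ_lt_succ h).le) x.2 =
        List.map (srcTo k n (Nat.lt_of_succ_lt_succ h).le) y.2
      rw [← List.forall₂_eq_eq_eq, List.forall₂_map_left_iff, List.forall₂_map_right_iff]
      exact hxy.2.imp fun _ _ => ih (Nat.lt_of_succ_lt_succ h) (X := X.shift)

/-- The value of a word in a strict `ω`-category. -/
noncomputable def eval : (n : ℕ) → {X : GlobularSet.{u}} → {C : StrictOmegaCat.{u}} →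
    Hom X C.toGlobularSet → Word n X → C.cells n
  | 0, _, _, f, x => f.app 0 x
  | n + 1, X, C, f, x =>
    C.pathComp (f.app 0 x.1) (x.2.map (eval n (X := X.shift) (C := C.shift) f.shift))

variable {n : ℕ} {X : GlobularSet.{u}} {C : StrictOmegaCat.{u}} (f : Hom X C.toGlobularSet)

/-- The value of a word of cells of positive dimension. -/
noncomputable def evalShift (y : Word n X.shift) : C.cells (n + 1) :=
  eval n (X := X.shift) (C := C.shift) f.shift y

theorem srcTo_zero_eq (Y : GlobularSet.{u}) (y : Y.cells (n + 1)) :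
    Y.srcTo (Nat.zero_le _) y = Y.src (Y.shift.srcTo (Nat.zero_le n) y) :=
  (Y.src_srcTo (Nat.succ_le_succ (Nat.zero_le n)) y).symm.trans
    (congrArg Y.src (Y.shift_srcTo (Nat.zero_le n) y).symm)

theorem tgtTo_zero_eq (Y : GlobularSet.{u}) (y : Y.cells (n + 1)) :
    Y.tgtTo (Nat.zero_le _) y = Y.tgt (Y.shift.tgtTo (Nat.zero_le n) y) :=
  (Y.tgt_tgtTo (Nat.succ_le_succ (Nat.zero_le n)) y).symm.trans
    (congrArg Y.tgt (Y.shift_tgtTo (Nat.zero_le n) y).symm)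

/-- The ends of the evaluated entries are taken as a hypothesis so that the induction in
`eval_first_last`, which needs this path to compute ends one dimension higher, can supply them. -/
theorem isCellPath_of_eval {x : Word (n + 1) X} (hx : Valid (n + 1) x)
    (h : ∀ y ∈ x.2, C.shift.srcTo (Nat.zero_le n) (eval n (X := X.shift) f.shift y) =
        f.app 1 (first n y) ∧
      C.shift.tgtTo (Nat.zero_le n) (eval n (X := X.shift) f.shift y) = f.app 1 (last n y)) :
    C.IsCellPath (f.app 0 x.1) (x.2.map (evalShift f)) := by
  refine (isPath_map _ _ _).2 ((isPath_congr (fun y hy => ?_) fun y hy => ?_).1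
    (hx.1.image (f.app 0)))
  · exact ((srcTo_zero_eq C.toGlobularSet _).trans
      ((congrArg C.src (h y hy).1).trans (f.app_src _).symm)).symm
  · exact ((tgtTo_zero_eq C.toGlobularSet _).trans
      ((congrArg C.tgt (h y hy).2).trans (f.app_tgt _).symm)).symm

theorem eval_first_last {x : Word n X} (hx : Valid n x) :
    C.srcTo (Nat.zero_le n) (eval n f x) = f.app 0 (first n x) ∧
      C.tgtTo (Nat.zero_le n) (eval n f x) = f.app 0 (last n x) := by
  induction n generalizing X C with
  | zero => exact ⟨C.srcTo_self _, C.tgtTo_self _⟩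
  | succ n ih =>
    have h := isCellPath_of_eval f hx fun y hy => ih (X := X.shift) (C := C.shift) f.shift (hx.2 y hy)
    refine ⟨h.srcTo_pathComp, h.tgtTo_pathComp.trans ?_⟩
    refine (pathEnd_map _ _ _).trans (Eq.trans ?_ (pathEnd_image _ (f.app 0) _ _))
    refine pathEnd_congr fun y hy => ?_
    exact ((tgtTo_zero_eq C.toGlobularSet _).trans
      ((congrArg C.tgt (ih (X := X.shift) (C := C.shift) f.shift (hx.2 y hy)).2).trans
        (f.app_tgt _).symm))

theorem isCellPath_eval {x : Word (n + 1) X} (hx : Valid (n + 1) x) :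
    C.IsCellPath (f.app 0 x.1) (x.2.map (evalShift f)) :=
  isCellPath_of_eval f hx fun y hy => eval_first_last (X := X.shift) (C := C.shift) f.shift (hx.2 y hy)

theorem eval_src {x : Word (n + 1) X} (hx : Valid (n + 1) x) :
    eval n f (Word.src n x) = C.src (eval (n + 1) f x) := by
  induction n generalizing X C with
  | zero =>
    have := (eval_first_last f hx).1
    rw [C.srcTo_succ le_rfl, C.srcTo_self] at this
    exact this.symm
  | succ n ih =>
    refine Eq.trans ?_ (isCellPath_eval f hx).src_pathComp.symm
    refine congrArg (C.pathComp (f.app 0 x.1)) ?_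
    refine List.map_map.trans (Eq.trans ?_ List.map_map.symm)
    exact List.map_congr_left (l := x.2) fun y hy =>
      ih (X := X.shift) (C := C.shift) f.shift (hx.2 y hy)

theorem eval_tgt {x : Word (n + 1) X} (hx : Valid (n + 1) x) :
    eval n f (Word.tgt n x) = C.tgt (eval (n + 1) f x) := by
  induction n generalizing X C with
  | zero =>
    have := (eval_first_last f hx).2
    rw [C.tgtTo_succ le_rfl, C.tgtTo_self] at this
    exact this.symm
  | succ n ih =>
    refine Eq.trans ?_ (isCellPath_eval f hx).tgt_pathComp.symm
    refine congrArg (C.pathComp (f.app 0 x.1)) ?_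
    refine List.map_map.trans (Eq.trans ?_ List.map_map.symm)
    exact List.map_congr_left (l := x.2) fun y hy =>
      ih (X := X.shift) (C := C.shift) f.shift (hx.2 y hy)

theorem eval_idn {x : Word n X} (hx : Valid n x) :
    eval (n + 1) f (Word.idn n x) = C.idn (eval n f x) := by
  induction n generalizing X C with
  | zero => exact (C.idnTo_succ le_rfl (f.app 0 x)).trans (congrArg C.idn (C.idnTo_self _))
  | succ n ih =>
    refine Eq.trans ?_ (isCellPath_eval f hx).idn_pathComp.symm
    refine congrArg (C.pathComp (f.app 0 x.1)) ?_
    refine List.map_map.trans (Eq.trans ?_ List.map_map.symm)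
    exact List.map_congr_left (l := x.2) fun y hy =>
      ih (X := X.shift) (C := C.shift) f.shift (hx.2 y hy)

/-- Evaluation as a map of globular sets. -/
noncomputable def evalHom : Hom X.words C.toGlobularSet where
  app n x := eval n f x.1
  app_src x := eval_src f x.2
  app_tgt x := eval_tgt f x.2

/-- Evaluation is already a map of globular sets, so it carries matching iterated boundaries of
words to matching boundaries in `C`. -/
theorem eval_composable {k : ℕ} (h : k < n) {x y : Word n X} (hx : Valid n x) (hy : Valid n y)
    (hxy : Composable k n x y) :
    C.tgtTo h.le (eval n f x) = C.srcTo h.le (eval n f y) := by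
  have e : X.words.tgtTo h.le ⟨x, hx⟩ = X.words.srcTo h.le ⟨y, hy⟩ :=
    Subtype.ext ((words_tgtTo _ h.le ⟨x, hx⟩).trans
      ((tgtTo_eq_of_composable h hxy).trans (words_srcTo _ h.le ⟨y, hy⟩).symm))
  exact ((evalHom f).app_tgtTo h.le ⟨x, hx⟩).symm.trans
    ((congrArg ((evalHom f).app k) e).trans ((evalHom f).app_srcTo h.le ⟨y, hy⟩))

/-- Along dimension 0 this is compatibility of `pathComp` with concatenation. Above it, the
induction hypothesis in `C.shift` treats each pair of entries, and iterated interchange moves the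
composition outside the path. -/
theorem eval_comp {k : ℕ} (h : k < n) {x y : Word n X} (hx : Valid n x) (hy : Valid n y)
    (hxy : Composable k n x y) :
    eval n f (Word.comp k n x y) = C.tcomp h (eval n f x) (eval n f y) := by
  induction n generalizing k X C with
  | zero => exact absurd h (Nat.not_lt_zero _)
  | succ n ih =>
    have hc := isCellPath_eval f (hx.comp hy hxy)
    have hcx := isCellPath_eval f hx
    have hcy := isCellPath_eval f hy
    obtain ⟨a, l⟩ := x
    obtain ⟨b, m⟩ := y
    cases k with
    | zero =>
      have e : C.pathComp (f.app 0 a) (List.map (evalShift f) (l ++ m)) =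
          C.pathComp (f.app 0 a) (List.map (evalShift f) l ++ List.map (evalShift f) m) :=
        congrArg _ List.map_append
      have hc' : C.IsCellPath (f.app 0 a) (List.map (evalShift f) l ++ List.map (evalShift f) m) :=
        List.map_append (f := evalShift f) ▸ hc
      refine (e.trans hc'.pathComp_append).trans ?_
      refine congrArg (fun b => C.tcomp n.succ_pos _ (C.pathComp b _)) ?_
      refine hcx.tgtTo_pathComp.symm.trans ((eval_first_last f hx).2.trans ?_)
      exact congrArg (f.app 0) hxy
    | succ k =>
      obtain ⟨rfl, h2⟩ := hxy
      have hk : k < n := Nat.lt_of_succ_lt_succ h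
      have h3 := forall₂_and_of_forall_mem (l := l) (m := m) h2 hx.2 hy.2
      refine Eq.trans ?_ (hcx.pathComp_zipWith hk hcy ?_)
      · refine congrArg (C.pathComp (f.app 0 a)) (map_zipWith_of_forall₂ (h3.imp fun y z h => ?_))
        exact (ih (X := X.shift) (C := C.shift) f.shift hk h.1 h.2.1 h.2.2).trans
          (C.shift_tcomp hk _ _)
      · refine List.forall₂_map_left_iff.2 (List.forall₂_map_right_iff.2 (h3.imp fun y z h => ?_))
        exact (C.toGlobularSet.shift_tgtTo hk.le _).symm.trans
          ((eval_composable (X := X.shift) (C := C.shift) f.shift hk h.1 h.2.1 h.2.2).trans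
            (C.toGlobularSet.shift_srcTo hk.le _))

end Word

/-- The strict `ω`-functor from the free strict `ω`-category induced by a map of globular sets. -/
noncomputable def lift {X : GlobularSet.{u}} {C : StrictOmegaCat.{u}}
    (f : Hom X C.toGlobularSet) : StrictOmegaCat.Hom X.free C where
  toHom := Word.evalHom f
  map_idn x := Word.eval_idn f x.2
  map_comp h x y hxy hfxy :=
    (Word.eval_comp f h x.2 y.2 (words_composable h hxy)).trans (C.tcomp_eq h hfxy)

namespace Word

/-- The word consisting of a single cell. -/
def single : (n : ℕ) → {X : GlobularSet.{u}} → X.cells n → Word n X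
  | 0, _, x => x
  | n + 1, X, x => (X.srcTo (Nat.zero_le _) x, [single n (X := X.shift) x])

variable {n : ℕ} {X : GlobularSet.{u}} {C : StrictOmegaCat.{u}}

theorem first_single (x : X.cells n) : first n (single n x) = X.srcTo (Nat.zero_le _) x := by
  cases n with
  | zero => exact (X.srcTo_self x).symm
  | succ n => rfl

theorem last_single (x : X.cells n) : last n (single n x) = X.tgtTo (Nat.zero_le _) x := by
  induction n generalizing X with
  | zero => exact (X.tgtTo_self x).symm
  | succ n ih =>
    exact (congrArg X.tgt (ih (X := X.shift) x)).trans (tgtTo_zero_eq X x).symm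

theorem valid_single (x : X.cells n) : Valid n (single n x) := by
  induction n generalizing X with
  | zero => trivial
  | succ n ih =>
    refine ⟨⟨?_, trivial⟩, ?_⟩
    · exact (congrArg X.src (first_single (X := X.shift) x)).trans (srcTo_zero_eq X x).symm
    · intro y hy
      rw [List.mem_singleton.1 hy]
      exact ih (X := X.shift) x

theorem single_src (x : X.cells (n + 1)) : single n (X.src x) = Word.src n (single (n + 1) x) := by
  induction n generalizing X with
  | zero => exact (X.srcTo_self _).symm.trans (X.srcTo_succ le_rfl x).symm
  | succ n ih =>
    refine Prod.ext (X.srcTo_succ (Nat.zero_le _) x).symm ?_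
    exact congrArg (fun y => [y]) (ih (X := X.shift) x)

theorem single_tgt (x : X.cells (n + 1)) : single n (X.tgt x) = Word.tgt n (single (n + 1) x) := by
  induction n generalizing X with
  | zero =>
    exact ((X.tgtTo_self _).symm.trans (X.tgtTo_succ le_rfl x).symm).trans (last_single x).symm
  | succ n ih =>
    refine Prod.ext (X.srcTo_tgt n.succ_pos x) ?_
    exact congrArg (fun y => [y]) (ih (X := X.shift) x)

/-- A path of length one evaluates to its cell followed by an identity, and the right unit law
removes the identity. -/
theorem eval_single (f : Hom X C.toGlobularSet) (x : X.cells n) :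
    eval n f (single n x) = f.app n x := by
  induction n generalizing X C with
  | zero => rfl
  | succ n ih =>
    have h : C.IsCellPath (f.app 0 _) [evalShift f (single n (X := X.shift) x)] :=
      isCellPath_eval f (valid_single (n := n + 1) x)
    have e : evalShift f (single n (X := X.shift) x) = f.app (n + 1) x :=
      ih (X := X.shift) (C := C.shift) f.shift x
    rw [e] at h
    have e' : eval (n + 1) f (single (n + 1) x) =
      C.pathComp (f.app 0 (X.srcTo (Nat.zero_le _) x)) [f.app (n + 1) x] :=
      congrArg (fun y => C.pathComp _ [y]) e
    exact e'.trans (h.pathComp_cons.trans (C.comp_idn n.succ_pos _ _))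

end Word

/-- The inclusion of a globular set in its free strict `ω`-category. -/
def unit (X : GlobularSet.{u}) : Hom X X.free.toGlobularSet where
  app _ x := ⟨Word.single _ x, Word.valid_single x⟩
  app_src x := Subtype.ext (Word.single_src x)
  app_tgt x := Subtype.ext (Word.single_tgt x)

end GlobularSet

/-! ### Uniqueness of extensions and the adjunction -/

namespace StrictOmegaCat

variable {C D : StrictOmegaCat.{u}}

/-- The functor induced on cells of positive dimension. -/
def Hom.shift (g : Hom C D) : Hom C.shift D.shift where
  toHom := g.toHom.shift
  map_idn x := g.map_idn x
  map_comp h x y _ _ := g.map_comp (Nat.succ_lt_succ h) x y _ _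

theorem Hom.map_idnTo (g : Hom C D) {k n : ℕ} (h : k ≤ n) (x : C.cells k) :
    g.app n (C.idnTo h x) = D.idnTo h (g.app k x) := by
  induction n, h using Nat.le_induction with
  | base => rw [C.idnTo_self, D.idnTo_self]
  | succ m h ih => rw [C.idnTo_succ h, D.idnTo_succ h, g.map_idn, ih]

theorem Hom.composable_map (g : Hom C D) {k n : ℕ} (h : k < n) {x y : C.cells n}
    (hxy : C.tgtTo h.le x = C.srcTo h.le y) :
    D.tgtTo h.le (g.app n x) = D.srcTo h.le (g.app n y) :=
  (g.toHom.app_tgtTo h.le x).symm.trans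
    ((congrArg (g.app k) hxy).trans (g.toHom.app_srcTo h.le y))

theorem Hom.app_comp_eq (g g' : Hom C D) {k n : ℕ} (h : k < n) {x y : C.cells n} (hxy)
    (hx : g.app n x = g'.app n x) (hy : g.app n y = g'.app n y) :
    g.app n (C.comp h x y hxy) = g'.app n (C.comp h x y hxy) := by
  rw [g.map_comp h x y hxy (g.composable_map h hxy),
    g'.map_comp h x y hxy (g'.composable_map h hxy)]
  exact D.comp_congr h hx hy _ _

end StrictOmegaCat

namespace GlobularSet

/-- The functor regarding a word of cells of positive dimension as a sequence of length one. -/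
def ofShift (X : GlobularSet.{u}) : StrictOmegaCat.Hom X.shift.free X.free.shift where
  app n y := ⟨(X.src (Word.first n y.1), [y.1]), ⟨rfl, trivial⟩, fun _ hz =>
    (List.mem_singleton.1 hz) ▸ y.2⟩
  app_src y := Subtype.ext (Prod.ext (congrArg X.src (Word.first_src (X := X.shift) y.1)) rfl)
  app_tgt y := Subtype.ext (Prod.ext (Word.src_first_tgt y.1 y.2) rfl)
  map_idn y := Subtype.ext (Prod.ext (congrArg X.src (Word.first_idn (X := X.shift) y.1)) rfl)
  map_comp _ y z _ _ :=
    Subtype.ext (Prod.ext (congrArg X.src (Word.first_comp (X := X.shift) y.1 z.1)) rfl)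

/-- Words are generated by single cells: an empty path is an iterated identity on a 0-cell, and a
nonempty path is its first entry, seen as a path of length one, composed along dimension 0 with the
rest. Paths of length one come from the free category on `X.shift`, where induction on dimension
applies. -/
theorem free_hom_ext {X : GlobularSet.{u}} {C : StrictOmegaCat.{u}}
    (g g' : StrictOmegaCat.Hom X.free C)
    (h : ∀ n (x : X.cells n), g.app n (X.unit.app n x) = g'.app n (X.unit.app n x)) (n : ℕ)
    (x : X.free.cells n) : g.app n x = g'.app n x := by
  induction n generalizing X C with
  | zero => exact h 0 x.1
  | succ n ih =>
    obtain ⟨⟨a, l⟩, hx⟩ := x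
    have key (y : X.shift.free.cells n) :
        g.app (n + 1) (X.ofShift.app n y) = g'.app (n + 1) (X.ofShift.app n y) := by
      -- Both functors are pulled back along `ofShift` to functors into `C.shift`. They need only be
      -- compared on generators, and `ofShift` sends the generators of `X.shift` to generators of
      -- `X` one dimension higher.
      refine ih (X := X.shift) (C := C.shift) (X.ofShift ≫ g.shift : X.shift.free ⟶ C.shift)
        (X.ofShift ≫ g'.shift : X.shift.free ⟶ C.shift) (fun m x => ?_) y
      have e : X.ofShift.app m (X.shift.unit.app m x) = X.unit.app (m + 1) x :=
        Subtype.ext (Prod.ext ((congrArg X.src (Word.first_single (X := X.shift) x)).trans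
          (Word.srcTo_zero_eq X x).symm) rfl)
      exact (congrArg (g.app (m + 1)) e).trans
        ((h (m + 1) x).trans (congrArg (g'.app (m + 1)) e).symm)
    induction l generalizing a with
    | nil =>
      have e : (⟨(a, []), hx⟩ : X.free.cells (n + 1)) =
          X.free.idnTo (Nat.zero_le _) (X.unit.app 0 a) :=
        Subtype.ext (X.words_idnTo (Nat.zero_le (n + 1)) (X.unit.app 0 a)).symm
      rw [e, g.map_idnTo, g'.map_idnTo, h 0 a]
    | cons y l ihl =>
      have hy : Word.Valid n y := hx.2 y List.mem_cons_self
      have hl : Word.Valid (n + 1) (X := X) (X.tgt (Word.last n y), l) :=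
        ⟨hx.1.2, fun z hz => hx.2 z (List.mem_cons_of_mem _ hz)⟩
      have hc : X.words.tgtTo (Nat.zero_le _) (X.ofShift.app n ⟨y, hy⟩) =
          X.words.srcTo (Nat.zero_le (n + 1)) ⟨_, hl⟩ :=
        Subtype.ext ((X.words_tgtTo _ _).trans (X.words_srcTo (Nat.zero_le (n + 1)) ⟨_, hl⟩).symm)
      have e : (⟨(a, y :: l), hx⟩ : X.free.cells (n + 1)) =
          X.free.comp n.succ_pos (X.ofShift.app n ⟨y, hy⟩) ⟨_, hl⟩ hc :=
        Subtype.ext (Prod.ext hx.1.1.symm rfl)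
      rw [e]
      exact g.app_comp_eq g' n.succ_pos hc (key _) (ihl _ hl)

/-- The restriction of a strict `ω`-functor to the generating cells. -/
def restrict {X : GlobularSet.{u}} {C : StrictOmegaCat.{u}} (g : StrictOmegaCat.Hom X.free C) :
    Hom X C.toGlobularSet where
  app n x := g.app n (X.unit.app n x)
  app_src x := by rw [X.unit.app_src, g.app_src]
  app_tgt x := by rw [X.unit.app_tgt, g.app_tgt]

/-- Strict `ω`-functors from the free strict `ω`-category correspond to maps of globular sets. -/
noncomputable def freeHomEquiv (X : GlobularSet.{u}) (C : StrictOmegaCat.{u}) :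
    (X.free ⟶ C) ≃ (X ⟶ StrictOmegaCat.forget.obj C) where
  toFun g := restrict g
  invFun f := lift f
  left_inv g := StrictOmegaCat.Hom.ext (funext fun n => funext fun x =>
    free_hom_ext (lift (restrict g)) g (fun _ x => Word.eval_single (restrict g) x) n x)
  right_inv f := Hom.ext (funext fun _ => funext fun x => Word.eval_single f x)

/-- The free strict `ω`-category functor. -/
noncomputable def freeFunctor : GlobularSet.{u} ⥤ StrictOmegaCat.{u} :=
  Adjunction.leftAdjointOfEquiv (G := StrictOmegaCat.forget) (F_obj := free) freeHomEquiv
    fun _ _ _ _ _ => rfl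

/-- The free strict `ω`-category functor is left adjoint to the forgetful functor. -/
noncomputable def freeAdjunction : freeFunctor.{u} ⊣ StrictOmegaCat.forget.{u} :=
  Adjunction.adjunctionOfEquivLeft freeHomEquiv fun _ _ _ _ _ => rfl

end GlobularSet

/-! ### Words as maps out of pasting diagrams -/

section Path

variable {V E : Type*}

theorem isPath_ofFn {s t : E → V} {r : ℕ} (v : Fin (r + 1) → V) (e : Fin r → E)
    (hs : ∀ i, s (e i) = v i.castSucc) (ht : ∀ i, t (e i) = v i.succ) :
    IsPath s t (v 0) (List.ofFn e) ∧ pathEnd t (v 0) (List.ofFn e) = v (Fin.last r) := by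
  induction r with
  | zero => simp [IsPath, pathEnd]
  | succ r ih =>
    obtain ⟨h1, h2⟩ := ih (fun i => v i.succ) (fun i => e i.succ) (fun i => hs i.succ)
      (fun i => ht i.succ)
    rw [List.ofFn_succ]
    refine ⟨⟨hs 0, ?_⟩, ?_⟩
    · rw [ht 0]
      exact h1
    · rw [pathEnd, ht 0]
      exact h2

theorem IsPath.exists_vertices {s t : E → V} {r : ℕ} {a : V} {e : Fin r → E}
    (h : IsPath s t a (List.ofFn e)) :
    ∃ v : Fin (r + 1) → V, v 0 = a ∧ ∀ i, s (e i) = v i.castSucc ∧ t (e i) = v i.succ := by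
  induction r generalizing a with
  | zero => exact ⟨fun _ => a, rfl, fun i => i.elim0⟩
  | succ r ih =>
    rw [List.ofFn_succ] at h
    obtain ⟨v, hv0, hv⟩ := ih h.2
    refine ⟨Fin.cases a v, rfl, Fin.cases ⟨h.1, hv0.symm⟩ fun i => ?_⟩
    exact hv i

end Path

namespace GlobularSet

/-- The restriction of a map out of a chain to one of its links. -/
def Hom.link {r : ℕ} {Y : Fin r → GlobularSet.{u}} {X : GlobularSet.{u}} (h : Hom (chain Y) X)
    (i : Fin r) : Hom (Y i) X.shift where
  app k x := h.app (k + 1) ⟨i, x⟩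
  app_src {k} x := h.app_src (n := k + 1) ⟨i, x⟩
  app_tgt {k} x := h.app_tgt (n := k + 1) ⟨i, x⟩

/-- A map out of a chain, given by its values on vertices and its restrictions to links. -/
def chainDesc {r : ℕ} {Y : Fin r → GlobularSet.{u}} {X : GlobularSet.{u}}
    (v : Fin (r + 1) → X.cells 0) (H : ∀ i, Hom (Y i) X.shift)
    (hs : ∀ i x, X.src ((H i).app 0 x) = v i.castSucc)
    (ht : ∀ i x, X.tgt ((H i).app 0 x) = v i.succ) : Hom (chain Y) X where
  app k := match k with
    | 0 => fun x => v x.down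
    | k + 1 => fun x => (H x.1).app k x.2
  app_src {k} x := match k with
    | 0 => (hs x.1 x.2).symm
    | _ + 1 => (H x.1).app_src x.2
  app_tgt {k} x := match k with
    | 0 => (ht x.1 x.2).symm
    | _ + 1 => (H x.1).app_tgt x.2

end GlobularSet

namespace Pd

open GlobularSet

/-- The first `0`-cell of the globular set represented by a pasting diagram. -/
def repFirst : (n : ℕ) → (π : Pd.{u} n) → (rep n π).cells 0
  | 0, _ => PUnit.unit
  | _ + 1, _ => ULift.up 0

/-- The last `0`-cell of the globular set represented by a pasting diagram. -/
def repLast : (n : ℕ) → (π : Pd.{u} n) → (rep n π).cells 0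
  | 0, _ => PUnit.unit
  | _ + 1, _ => ULift.up (Fin.last _)

/-- The globular set of a pasting diagram is connected: each link has at least one 0-cell, which is
a 1-cell of the chain joining consecutive vertices. -/
theorem apply_rep_eq {V : Type*} {n : ℕ} {π : Pd.{u} n} {X : GlobularSet.{u}}
    (h : GlobularSet.Hom (rep n π) X) (q : X.cells 0 → V)
    (hq : ∀ e : X.cells 1, q (X.src e) = q (X.tgt e)) (c : (rep n π).cells 0) :
    q (h.app 0 c) = q (h.app 0 (repFirst n π)) := by
  cases n with
  | zero => rfl
  | succ n =>
    obtain ⟨j⟩ := c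
    induction j using Fin.induction with
    | zero => rfl
    | succ i ih =>
      rw [← ih]
      have e1 := h.app_src (n := 0) ⟨i, repFirst n _⟩
      have e2 := h.app_tgt (n := 0) ⟨i, repFirst n _⟩
      exact (congrArg q e2).trans ((hq _).symm.trans (congrArg q e1.symm))

/-- The word described by a map out of the globular set represented by a pasting diagram. -/
def toWord : (n : ℕ) → (π : Pd.{u} n) → {X : GlobularSet.{u}} → GlobularSet.Hom (rep n π) X →
    Word n X
  | 0, _, _, h => h.app 0 PUnit.unit
  | n + 1, π, X, h =>
    (h.app 0 (ULift.up 0), List.ofFn fun i : Fin (List.length π) =>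
      toWord n (List.get π i) (X := X.shift) (h.link i))

variable {n : ℕ} {π : Pd.{u} n} {X Y : GlobularSet.{u}}

theorem first_toWord (h : GlobularSet.Hom (rep n π) X) :
    Word.first n (toWord n π h) = h.app 0 (repFirst n π) := by
  cases n <;> rfl

/-- The two claims are proved together, because joining the entries into a path requires knowing
where each entry ends. -/
theorem toWord_spec (h : GlobularSet.Hom (rep n π) X) :
    Word.Valid n (toWord n π h) ∧ Word.last n (toWord n π h) = h.app 0 (repLast n π) := by
  induction n generalizing X with
  | zero => exact ⟨trivial, rfl⟩
  | succ n ih =>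
    have key := isPath_ofFn (s := fun y => X.src (Word.first n (X := X.shift) y))
      (t := fun y => X.tgt (Word.last n (X := X.shift) y))
      (fun j : Fin (List.length π + 1) => h.app 0 (ULift.up j))
      (fun i => toWord n (List.get π i) (X := X.shift) (h.link i))
      (fun i => (congrArg X.src (first_toWord (X := X.shift) (h.link i))).trans
        (h.app_src (n := 0) ⟨i, repFirst n _⟩).symm)
      (fun i => (congrArg X.tgt (ih (X := X.shift) (h.link i)).2).trans
        (h.app_tgt (n := 0) ⟨i, repLast n _⟩).symm)
    refine ⟨⟨key.1, fun y hy => ?_⟩, key.2⟩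
    obtain ⟨i, rfl⟩ := (List.mem_ofFn' _ _).1 hy
    exact (ih (X := X.shift) (h.link i)).1

/-- The word records the image of vertex 0 and, recursively, of each link. Every later vertex is the
target of a 1-cell in a link, so its image is forced. -/
theorem toWord_injective : Function.Injective (toWord n π (X := X)) := by
  intro h h' e
  induction n generalizing X with
  | zero =>
    refine GlobularSet.Hom.ext (funext fun k => funext fun x => ?_)
    cases k with
    | zero => exact e
    | succ k => exact PEmpty.elim x
  | succ n ih =>
    have e0 : h.app 0 (ULift.up 0) = h'.app 0 (ULift.up 0) :=
      congrArg (fun p : Word (n + 1) X => p.1) e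
    have e1 := List.ofFn_injective (congrArg (fun p : Word (n + 1) X => p.2) e)
    have e2 (i) : h.link i = h'.link i := ih (X := X.shift) (congrFun e1 i)
    have e3 (k) (x : (rep (n + 1) π).cells (k + 1)) : h.app (k + 1) x = h'.app (k + 1) x :=
      congrArg (fun g : GlobularSet.Hom (rep n (List.get π x.1)) X.shift => g.app k x.2) (e2 x.1)
    refine GlobularSet.Hom.ext (funext fun k => funext fun x => ?_)
    cases k with
    | zero =>
      obtain ⟨j⟩ := x
      induction j using Fin.cases with
      | zero => exact e0
      | succ i =>
        exact (h.app_tgt (n := 0) ⟨i, repFirst n _⟩).trans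
          ((congrArg X.tgt (e3 0 _)).trans (h'.app_tgt (n := 0) ⟨i, repFirst n _⟩).symm)
    | succ k => exact e3 k x

theorem exists_toWord_eq (x : Word n X) (hx : Word.Valid n x) :
    ∃ (π : Pd.{u} n) (h : GlobularSet.Hom (rep n π) X), toWord n π h = x := by
  induction n generalizing X with
  | zero =>
    refine ⟨PUnit.unit, ⟨fun k => match k with
      | 0 => fun _ => x
      | _ + 1 => fun y => PEmpty.elim y, fun y => PEmpty.elim y, fun y => PEmpty.elim y⟩, rfl⟩
  | succ n ih =>
    obtain ⟨a, l⟩ := x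
    obtain ⟨hp, hv⟩ := hx
    have key : ∃ (π : List (Pd.{u} n))
        (H : ∀ i : Fin π.length, GlobularSet.Hom (rep n (π.get i)) X.shift),
        (List.ofFn fun i => toWord n (π.get i) (H i)) = l := by
      clear hp
      dsimp only at hv
      induction l with
      | nil => exact ⟨[], fun i => i.elim0, rfl⟩
      | cons y l ihl =>
        simp only [List.mem_cons, forall_eq_or_imp] at hv
        obtain ⟨π, H, e⟩ := ihl hv.2
        obtain ⟨p, h, e'⟩ := ih (X := X.shift) y hv.1
        refine ⟨p :: π, Fin.cases h H, ?_⟩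
        rw [← e, ← e']
        exact List.ofFn_succ
    obtain ⟨π, H, rfl⟩ := key
    obtain ⟨v, rfl, hv'⟩ := IsPath.exists_vertices hp
    -- Gluing the links requires every 0-cell of link `i` to map to a 1-cell from `v i.castSucc` to
    -- `v i.succ`. The path condition gives the source only for the first 0-cell and the target only
    -- for the last; connectedness of the link extends both to all.
    refine ⟨π, chainDesc v H (fun i c => ?_) (fun i c => ?_), rfl⟩
    · exact (apply_rep_eq (H i) X.src X.src_src c).trans
        ((congrArg X.src (first_toWord (H i)).symm).trans (hv' i).1)
    · refine (apply_rep_eq (H i) X.tgt X.tgt_tgt c).trans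
        ((apply_rep_eq (H i) X.tgt X.tgt_tgt (repLast n _)).symm.trans ?_)
      exact (congrArg X.tgt (toWord_spec (H i)).2.symm).trans (hv' i).2

end Pd

/-! ### Shapes of words and functoriality -/

namespace GlobularSet.Word

variable {n : ℕ} {X Y : GlobularSet.{u}}

/-- The pasting diagram underlying a word. -/
def shape : (n : ℕ) → {X : GlobularSet.{u}} → Word n X → Pd.{u} n
  | 0, _, _ => PUnit.unit
  | n + 1, X, x => List.map (shape n (X := X.shift)) x.2

theorem shape_src (x : Word (n + 1) X) :
    shape n (Word.src n x) = Pd.boundary n (shape (n + 1) x) := by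
  induction n generalizing X with
  | zero => rfl
  | succ n ih =>
    refine List.map_map.trans (Eq.trans ?_ List.map_map.symm)
    exact List.map_congr_left (l := x.2) fun y _ => ih (X := X.shift) y

theorem shape_tgt (x : Word (n + 1) X) :
    shape n (Word.tgt n x) = Pd.boundary n (shape (n + 1) x) := by
  induction n generalizing X with
  | zero => rfl
  | succ n ih =>
    refine List.map_map.trans (Eq.trans ?_ List.map_map.symm)
    exact List.map_congr_left (l := x.2) fun y _ => ih (X := X.shift) y

/-- The diagram can be recovered from the word, so words coming from different diagrams are
different. -/
theorem shape_toWord {π : Pd.{u} n} (h : GlobularSet.Hom (Pd.rep n π) X) :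
    shape n (Pd.toWord n π h) = π := by
  induction n generalizing X with
  | zero => rfl
  | succ n ih =>
    refine List.map_ofFn.trans (Eq.trans ?_ (List.ofFn_get π))
    exact congrArg List.ofFn (funext fun i => ih (X := X.shift) (h.link i))

/-- The action of a map of globular sets on words. -/
def map : (n : ℕ) → {X Y : GlobularSet.{u}} → Hom X Y → Word n X → Word n Y
  | 0, _, _, f, x => f.app 0 x
  | n + 1, X, Y, f, x => (f.app 0 x.1, List.map (map n (X := X.shift) (Y := Y.shift) f.shift) x.2)

variable (f : Hom X Y)

theorem shape_map (x : Word n X) : shape n (map n f x) = shape n x := by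
  induction n generalizing X Y with
  | zero => rfl
  | succ n ih =>
    refine List.map_map.trans ?_
    exact List.map_congr_left (l := x.2) fun y _ => ih (X := X.shift) (Y := Y.shift) f.shift y

theorem map_toWord {π : Pd.{u} n} (h : Pd.rep n π ⟶ X) :
    map n f (Pd.toWord n π h) = Pd.toWord n π (h ≫ (f : X ⟶ Y)) := by
  induction n generalizing X Y with
  | zero => rfl
  | succ n ih =>
    refine Prod.ext rfl (List.map_ofFn.trans ?_)
    exact congrArg List.ofFn
      (funext fun i => ih (X := X.shift) (Y := Y.shift) f.shift (Hom.link h i))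

theorem first_map (x : Word n X) : first n (map n f x) = f.app 0 (first n x) := by
  cases n <;> rfl

theorem last_map (x : Word n X) : last n (map n f x) = f.app 0 (last n x) := by
  induction n generalizing X Y with
  | zero => rfl
  | succ n ih =>
    refine (pathEnd_map _ _ _).trans (Eq.trans ?_ (pathEnd_image _ (f.app 0) _ _))
    exact pathEnd_congr fun y _ =>
      (congrArg Y.tgt (ih (X := X.shift) (Y := Y.shift) f.shift y)).trans (f.app_tgt _).symm

theorem Valid.map {x : Word n X} (hx : Valid n x) : Valid n (map n f x) := by
  induction n generalizing X Y with
  | zero => trivial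
  | succ n ih =>
    refine ⟨(isPath_map _ _ _).2 ((isPath_congr (fun y _ => ?_) fun y _ => ?_).1
      (hx.1.image (f.app 0))), ?_⟩
    · exact (f.app_src _).trans
        (congrArg Y.src (first_map (X := X.shift) (Y := Y.shift) f.shift y).symm)
    · exact (f.app_tgt _).trans
        (congrArg Y.tgt (last_map (X := X.shift) (Y := Y.shift) f.shift y).symm)
    · intro z hz
      obtain ⟨y, hy, rfl⟩ := List.mem_map.1 hz
      exact ih (X := X.shift) (Y := Y.shift) f.shift (hx.2 y hy)

theorem map_src (x : Word (n + 1) X) : map n f (Word.src n x) = Word.src n (map (n + 1) f x) := by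
  induction n generalizing X Y with
  | zero => rfl
  | succ n ih =>
    refine Prod.ext rfl (List.map_map.trans (Eq.trans ?_ List.map_map.symm))
    exact List.map_congr_left (l := x.2) fun y _ => ih (X := X.shift) (Y := Y.shift) f.shift y

theorem map_tgt (x : Word (n + 1) X) : map n f (Word.tgt n x) = Word.tgt n (map (n + 1) f x) := by
  induction n generalizing X Y with
  | zero => exact (last_map f x).symm
  | succ n ih =>
    refine Prod.ext rfl (List.map_map.trans (Eq.trans ?_ List.map_map.symm))
    exact List.map_congr_left (l := x.2) fun y _ => ih (X := X.shift) (Y := Y.shift) f.shift y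

theorem map_idn (x : Word n X) : map (n + 1) f (Word.idn n x) = Word.idn n (map n f x) := by
  induction n generalizing X Y with
  | zero => rfl
  | succ n ih =>
    refine Prod.ext rfl (List.map_map.trans (Eq.trans ?_ List.map_map.symm))
    exact List.map_congr_left (l := x.2) fun y _ => ih (X := X.shift) (Y := Y.shift) f.shift y

theorem map_comp {k : ℕ} (x y : Word n X) :
    map n f (Word.comp k n x y) = Word.comp k n (map n f x) (map n f y) := by
  induction n generalizing k X Y with
  | zero => cases k <;> rfl
  | succ n ih =>
    cases k with
    | zero => exact Prod.ext rfl List.map_append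
    | succ k =>
      refine Prod.ext rfl (List.map_zipWith.trans (Eq.trans ?_ List.zipWith_map.symm))
      exact congrArg (fun g => List.zipWith g x.2 y.2) (funext fun y => funext fun z =>
        ih (X := X.shift) (Y := Y.shift) f.shift y z)

theorem map_single (x : X.cells n) : map n f (single n x) = single n (f.app n x) := by
  induction n generalizing X Y with
  | zero => rfl
  | succ n ih =>
    refine Prod.ext (f.app_srcTo (Nat.zero_le (n + 1)) x) ?_
    exact congrArg (fun y => [y]) (ih (X := X.shift) (Y := Y.shift) f.shift x)

end GlobularSet.Word

/-! ### The bijection with pasting diagrams and the terminal case -/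

namespace GlobularSet

/-- The strict `ω`-functor between free strict `ω`-categories induced by a map of globular
sets. -/
def freeMap {X Y : GlobularSet.{u}} (f : Hom X Y) : StrictOmegaCat.Hom X.free Y.free where
  app n x := ⟨Word.map n f x.1, x.2.map f⟩
  app_src x := Subtype.ext (Word.map_src f x.1)
  app_tgt x := Subtype.ext (Word.map_tgt f x.1)
  map_idn x := Subtype.ext (Word.map_idn f x.1)
  map_comp _ x y _ _ := Subtype.ext (Word.map_comp f x.1 y.1)

/-- The adjunction defines the action on maps by extension from generators; the explicit
cell-by-cell action agrees with it on single cells, hence everywhere. -/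
theorem freeFunctor_map {X Y : GlobularSet.{u}} (f : X ⟶ Y) :
    freeFunctor.map f = (freeMap f : X.free ⟶ Y.free) :=
  (Equiv.symm_apply_eq (freeHomEquiv X Y.free)).2
    (Hom.ext (funext fun _ => funext fun x => Subtype.ext (Word.map_single f x).symm))

/-- Maps out of the globular sets represented by pasting diagrams correspond to cells of the
free strict `ω`-category. -/
noncomputable def repEquiv (X : GlobularSet.{u}) (n : ℕ) :
    (Σ π : Pd.{u} n, (Pd.rep n π ⟶ X)) ≃ X.words.cells n :=
  Equiv.ofBijective (fun p => ⟨Pd.toWord n p.1 p.2, (Pd.toWord_spec p.2).1⟩) <| by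
    refine ⟨?_, fun x => ?_⟩
    · rintro ⟨π, h⟩ ⟨π', h'⟩ e
      have e' : Pd.toWord n π h = Pd.toWord n π' h' := congrArg Subtype.val e
      obtain rfl : π = π' := by rw [← Word.shape_toWord h, e', Word.shape_toWord]
      rw [Pd.toWord_injective e']
    · obtain ⟨π, h, e⟩ := Pd.exists_toWord_eq x.1 x.2
      exact ⟨⟨π, h⟩, Subtype.ext e⟩

theorem repEquiv_symm_fst {X : GlobularSet.{u}} {n : ℕ} (x : X.words.cells n) :
    ((X.repEquiv n).symm x).1 = Word.shape n x.1 := by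
  conv_rhs => rw [← (X.repEquiv n).apply_symm_apply x]
  exact (Word.shape_toWord _).symm

theorem repEquiv_symm_map {X Y : GlobularSet.{u}} (f : X ⟶ Y) {n : ℕ} (x : X.words.cells n) :
    (Y.repEquiv n).symm ((freeMap f).app n x) =
      ⟨((X.repEquiv n).symm x).1, ((X.repEquiv n).symm x).2 ≫ f⟩ := by
  refine (Equiv.symm_apply_eq _).2 ?_
  refine (congrArg ((freeMap f).app n) ((X.repEquiv n).apply_symm_apply x).symm).trans ?_
  exact Subtype.ext (Word.map_toWord f _)

/-- An isomorphism of globular sets is bijective on cells. -/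
def isoEquiv {X Y : GlobularSet.{u}} (i : X ≅ Y) (n : ℕ) : X.cells n ≃ Y.cells n where
  toFun := i.hom.app n
  invFun := i.inv.app n
  left_inv x := congrArg (fun g : Hom X X => g.app n x) i.hom_inv_id
  right_inv x := congrArg (fun g : Hom Y Y => g.app n x) i.inv_hom_id

/-- A map of globular sets that is bijective on cells is an isomorphism. -/
def isoOfEquiv {X Y : GlobularSet.{u}} (e : ∀ n, X.cells n ≃ Y.cells n)
    (hs : ∀ n (x : X.cells (n + 1)), e n (X.src x) = Y.src (e (n + 1) x))
    (ht : ∀ n (x : X.cells (n + 1)), e n (X.tgt x) = Y.tgt (e (n + 1) x)) : X ≅ Y where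
  hom := { app n := e n, app_src := hs _, app_tgt := ht _ }
  inv :=
    { app n := (e n).symm
      app_src x := by rw [Equiv.symm_apply_eq, hs, Equiv.apply_symm_apply]
      app_tgt x := by rw [Equiv.symm_apply_eq, ht, Equiv.apply_symm_apply] }
  hom_inv_id := Hom.ext (funext fun n => funext fun x => (e n).symm_apply_apply x)
  inv_hom_id := Hom.ext (funext fun n => funext fun x => (e n).apply_symm_apply x)

/-- The cells of the free strict `ω`-category on the terminal globular set are pasting
diagrams. -/
noncomputable def wordsOneIso : one.{u}.words ≅ Pd.globularSet.{u} :=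
  isoOfEquiv
    (fun n => Equiv.ofBijective (fun x => Word.shape n x.1) <| by
      -- Every pasting diagram has exactly one map to the terminal globular set: existence makes
      -- `shape` surjective and uniqueness makes it injective.
      refine ⟨fun x y h => ?_, fun π => ⟨one.repEquiv n ⟨π, toOne _⟩, Word.shape_toWord _⟩⟩
      apply (one.repEquiv n).symm.injective
      dsimp only at h
      rw [← repEquiv_symm_fst, ← repEquiv_symm_fst] at h
      generalize (one.repEquiv n).symm x = p at h ⊢
      generalize (one.repEquiv n).symm y = q at h ⊢
      obtain ⟨π, p⟩ := p
      obtain ⟨π', q⟩ := q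
      obtain rfl : π = π' := h
      exact congrArg (Sigma.mk π) (Hom.ext (funext fun _ => funext fun _ => rfl)))
    (fun _ x => Word.shape_src x.1) (fun _ x => Word.shape_tgt x.1)

end GlobularSet

theorem mainTheorem12 :
    StrictOmegaCat.forget.{u}.IsRightAdjoint ∧
    ∀ (F : GlobularSet.{u} ⥤ StrictOmegaCat.{u}) (adj : F ⊣ StrictOmegaCat.forget.{u})
      (T : Monad GlobularSet.{u}), T = adj.toMonad →
      ∃ (φ : T.obj GlobularSet.one.{u} ≅ Pd.globularSet.{u})
        (θ : ∀ (X : GlobularSet.{u}) (n : ℕ),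
          (T.obj X).cells n ≃ Σ π : Pd.{u} n, (Pd.rep n π ⟶ X)),
        (∀ (X Y : GlobularSet.{u}) (f : X ⟶ Y) (n : ℕ) (a : (T.obj X).cells n),
          θ Y n ((T.map f).app n a) = ⟨(θ X n a).1, (θ X n a).2 ≫ f⟩) ∧
        (∀ (X : GlobularSet.{u}) (n : ℕ) (a : (T.obj X).cells n),
          (θ X n a).1 = φ.hom.app n ((T.map X.toOne).app n a)) := by
  refine ⟨GlobularSet.freeAdjunction.isRightAdjoint, ?_⟩
  rintro F adj T rfl
  -- The given left adjoint is arbitrary; uniqueness identifies it, naturally in `X`, with the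
  -- explicit construction.
  let e : F ≅ GlobularSet.freeFunctor := adj.leftAdjointUniq GlobularSet.freeAdjunction
  let i (X : GlobularSet.{u}) : StrictOmegaCat.forget.obj (F.obj X) ≅ X.words :=
    StrictOmegaCat.forget.mapIso (e.app X)
  have hi {X Y : GlobularSet.{u}} (f : X ⟶ Y) (n : ℕ) (a : (F.obj X).cells n) :
      (i Y).hom.app n ((F.map f).app n a) = (GlobularSet.freeMap f).app n ((i X).hom.app n a) := by
    rw [← GlobularSet.freeFunctor_map]
    exact congrArg (fun g : F.obj X ⟶ GlobularSet.freeFunctor.obj Y => g.app n a) (e.hom.naturality f)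
  refine ⟨i GlobularSet.one ≪≫ GlobularSet.wordsOneIso,
    fun X n => (GlobularSet.isoEquiv (i X) n).trans (X.repEquiv n).symm, ?_, ?_⟩
  · intro X Y f n a
    exact (congrArg (Y.repEquiv n).symm (hi f n a)).trans (GlobularSet.repEquiv_symm_map f _)
  · intro X n a
    refine (GlobularSet.repEquiv_symm_fst _).trans ?_
    -- The index is the shape of the word, and replacing all cells by those of the terminal globular
    -- set leaves the shape unchanged.
    exact (GlobularSet.Word.shape_map X.toOne _).symm.trans
      (congrArg (fun x : GlobularSet.one.words.cells n => GlobularSet.Word.shape n x.1)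
        (hi X.toOne n a).symm)
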